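/- Let $F\subseteq\mathbb{R}$ be a subfield, let $\Phi$ be a finite (not necessarily crystallographic) root system over $F$ with a basis $B$, so that all values $\langle\beta,\alpha^\vee\rangle$ lie in $F$, and let $\overline{W}$ be its spherical Weyl group. Let $\Lambda$ be a totally ordered abelian group which is an ordered $F$-module. Let $\mathbb{A}=\mathrm{span}_F(\Phi)\otimes_F\Lambda$ be the model space, let $T$ be a $\overline{W}$-invariant subgroup of $\mathbb{A}$, acting by translations, and put $W_T=\overline{W}\ltimes T$ and $W=\overline{W}\ltimes\mathbb{A}$. The fundamental Weyl chamber is $\{x:\langle x,\alpha^\vee\rangle\ge 0\ \forall\alpha\in B\}$; Weyl chambers of $\mathbb{A}$ are its images under $W$, and half-apartments of $\mathbb{A}$ are the images under $W$ of the half-spaces $\{x:\langle x,\alpha^\vee\rangle\ge 0\}$, $\alpha\in\Phi$. A subset of $\mathbb{A}$ is convex if it is an intersection of half-apartments. Let $d$ be a $W$-invariant $\Lambda$-valued metric on $\mathbb{A}$ inducing the natural topology (the product of the order topologies on $\mathbb{A}\cong\Lambda^n$). Let $X$ be a set with a collection $\mathcal{A}$ of injective maps (charts) $f:\mathbb{A}\to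 X$ whose images cover $X$. Apartments of $X$ are the images of the charts, and Weyl chambers of $X$ are the images of Weyl chambers of $\mathbb{A}$ under charts; the image of $v+w(C)$, where $C$ is the fundamental chamber and $w\in\overline W$, under $f$ is said to be based at $f(v)$. The ball $B_\varepsilon(x)$ is the set of all $y\in X$ such that $f(a)=x$, $f(b)=y$ and $d(a,b)<\varepsilon$ for some $f\in\mathcal A$ and $a,b\in\mathbb{A}$. Two $x$-based Weyl chambers $S,T$ have the same germ at $x$ if $S\cap T$ is a neighbourhood of $x$ in $S$ and in $T$; the germ of $S$ at $x$ is contained in $Y\subseteq X$ if $S\cap B_\varepsilon(x)\subseteq Y$ for some $\varepsilon>0$ in $\Lambda$. Two $x$-based Weyl chambers are opposite if, in some apartment containing both germs, these germs are the germs of a chamber and of its image under the longest element of $\overline W$; that is, they are the germs of $f(v+w(C))$ and $f(v+ww_0(C))$ for some $f\in\mathcal A$, $v$ with $f(v)=x$ and $w\in\overline W$, where $w_0$ is the longest element. Assume: - (A1) $f\circ\varphi\in\mathcal{A}$ for all $f\in\mathcal{A}$ and $\varphi\in W_T$. - (A2) If $f,g\in\mathcal{A}$ and $f(\mathbb{A})\cap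 g(\mathbb{A})\ne\emptyset$, then $f^{-1}(g(\mathbb{A}))$ is a closed convex subset of $\mathbb{A}$, and there is $\varphi\in W_T$ with $f=g\circ\varphi$ on $f^{-1}(g(\mathbb{A}))$. - (A3) Any two points of $X$ lie in a common apartment. - (GG) Any two germs of Weyl chambers based at the same point are contained in a common apartment. - (CO) Any two opposite $x$-based Weyl chambers are contained in a unique common apartment. Then (A4) holds: for any two Weyl chambers $S,T$ of $X$ there are Weyl chambers $S'\subseteq S$ and $T'\subseteq T$ which are contained in a common apartment. -/

import Mathlib

open scoped TensorProduct

noncomputable section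

namespace LambdaBuilding

/-! ### The model space

`F` is a subfield of `ℝ`, `P` is a finite (not necessarily crystallographic) root system over `F` in
the vector space `V` spanned by its roots, and `Λ` is a totally ordered abelian group which is an
ordered `F`-module. -/

section Model

variable {F : Subfield ℝ} {ι V N : Type*}
  [AddCommGroup V] [Module F V] [AddCommGroup N] [Module F N]

/-- The spherical Weyl group, generated by the reflections at the roots. -/
def weylGroup (P : RootPairing ι F V N) : Subgroup (V ≃ₗ[F] V) :=
  Subgroup.closure (Set.range P.reflection)

/-- The cone of all linear combinations, with nonnegative coefficients in `F`, of the roots with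
index in `B`. -/
def rootCone (P : RootPairing ι F V N) (B : Set ι) : Set V :=
  {v | ∃ c : ι →₀ F, (∀ i, 0 ≤ c i) ∧ (∀ i ∉ B, c i = 0) ∧ v = c.sum fun i a => a • P.root i}

/-- `B` indexes a basis (simple system) of the root system: the roots in `B` are linearly
independent, and every root is a combination of them with coefficients all of the same sign. -/
structure IsRootBasis (P : RootPairing ι F V N) (B : Set ι) : Prop where
  linearIndepOn : LinearIndepOn F P.root B
  pos_or_neg : ∀ i, P.root i ∈ rootCone P B ∨ -P.root i ∈ rootCone P B

/-- The longest element of the spherical Weyl group with respect to the basis `B`: the element which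
maps all simple (hence all positive) roots to negative roots. -/
def IsLongest (P : RootPairing ι F V N) (B : Set ι) (w : V ≃ₗ[F] V) : Prop :=
  w ∈ weylGroup P ∧ ∀ i ∈ B, -(w (P.root i)) ∈ rootCone P B

variable (Λ : Type*) [AddCommGroup Λ] [LinearOrder Λ] [Module F Λ]

/-- The model space `span_F(Φ) ⊗ Λ`; here `V` is the `F`-span of the roots. -/
abbrev Model (_P : RootPairing ι F V N) : Type _ := V ⊗[F] Λ

variable {Λ}

/-- The extension to the model space of the action of the spherical Weyl group. -/
def act (w : V ≃ₗ[F] V) : V ⊗[F] Λ ≃ₗ[F] V ⊗[F] Λ := LinearEquiv.rTensor Λ w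

/-- The evaluation `⟨x, αᵢ^∨⟩ ∈ Λ` of the `i`-th coroot at a point of the model space. -/
def ev (P : RootPairing ι F V N) (i : ι) : Model Λ P →ₗ[F] Λ :=
  (TensorProduct.lid F Λ).toLinearMap ∘ₗ LinearMap.rTensor Λ (P.coroot' i)

/-- The affine Weyl group with translation group `T`, as a set of self-maps of the model space. -/
def affineWeyl (P : RootPairing ι F V N) (T : AddSubgroup (Model Λ P)) :
    Set (Model Λ P → Model Λ P) :=
  {φ | ∃ w ∈ weylGroup P, ∃ t ∈ T, φ = fun x => act w x + t}

/-- The half-apartments of the model space: the images, under the full affine Weyl group, of the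
half-spaces bounded by the hyperplanes fixed by the reflections. -/
def IsHalfApartment (P : RootPairing ι F V N) (H : Set (Model Λ P)) : Prop :=
  ∃ φ ∈ affineWeyl P (⊤ : AddSubgroup (Model Λ P)), ∃ i, H = φ '' {x | 0 ≤ ev P i x}

/-- A subset of the model space is convex if it is an intersection of half-apartments. -/
def IsConvex (P : RootPairing ι F V N) (Y : Set (Model Λ P)) : Prop :=
  ∃ 𝓗 : Set (Set (Model Λ P)), (∀ H ∈ 𝓗, IsHalfApartment P H) ∧ Y = ⋂₀ 𝓗

/-- The fundamental Weyl chamber associated to the basis `B`. -/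
def fundChamber (P : RootPairing ι F V N) (B : Set ι) : Set (Model Λ P) :=
  {x | ∀ i ∈ B, 0 ≤ ev P i x}

/-- The Weyl chamber of the model space based at `v` which has the direction of the image under `w`
of the fundamental Weyl chamber. -/
def chamber (P : RootPairing ι F V N) (B : Set ι) (v : Model Λ P) (w : V ≃ₗ[F] V) :
    Set (Model Λ P) :=
  (fun x => act w x + v) '' fundChamber P B

/-- `d` is a `Λ`-metric on the model space which is invariant under the full affine Weyl group and
induces the natural topology: the one with the boxes `{y | ∀ i, |⟨y - x, αᵢ^∨⟩| < η}`, `η > 0`, as a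
base of neighbourhoods of `x` (in coordinates, the product of the order topologies on `Λⁿ`). -/
structure IsModelMetric (P : RootPairing ι F V N) (d : Model Λ P → Model Λ P → Λ) : Prop where
  eq_zero_iff : ∀ x y, d x y = 0 ↔ x = y
  symm : ∀ x y, d x y = d y x
  triangle : ∀ x y z, d x y ≤ d x z + d z y
  invariant : ∀ φ ∈ affineWeyl P (⊤ : AddSubgroup (Model Λ P)), ∀ x y, d (φ x) (φ y) = d x y
  box_subset_ball : ∀ ε : Λ, 0 < ε → ∃ η : Λ, 0 < η ∧
    ∀ x y, (∀ i, |ev P i (y - x)| < η) → d x y < ε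
  ball_subset_box : ∀ η : Λ, 0 < η → ∃ ε : Λ, 0 < ε ∧
    ∀ x y, d x y < ε → ∀ i, |ev P i (y - x)| < η

/-- Closedness of a subset of the model space with respect to the metric `d`. -/
def IsClosedFor {P : RootPairing ι F V N} (d : Model Λ P → Model Λ P → Λ)
    (Y : Set (Model Λ P)) : Prop :=
  ∀ y, (∀ ε : Λ, 0 < ε → ∃ z ∈ Y, d y z < ε) → y ∈ Y

end Model

/-! ### Spaces modeled on the model space -/

section Space

variable {F : Subfield ℝ} {ι V N : Type*}
  [AddCommGroup V] [Module F V] [AddCommGroup N] [Module F N]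
  {Λ : Type*} [AddCommGroup Λ] [LinearOrder Λ] [Module F Λ]
  {X : Type*}

/-- `X` is a space modeled on the model space with atlas `𝒜`: the charts are injective and their
images cover `X`. -/
structure IsModeledOn (P : RootPairing ι F V N) (𝒜 : Set (Model Λ P → X)) : Prop where
  injective : ∀ f ∈ 𝒜, Function.Injective f
  cover : ∀ x : X, ∃ f ∈ 𝒜, x ∈ Set.range f

/-- The apartments of `X` are the images of the charts. -/
def IsApartment {P : RootPairing ι F V N} (𝒜 : Set (Model Λ P → X)) (A : Set X) : Prop :=
  ∃ f ∈ 𝒜, A = Set.range f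

/-- `S` is a Weyl chamber of `X` based at `x`. -/
def IsChamberAt {P : RootPairing ι F V N} (B : Set ι) (𝒜 : Set (Model Λ P → X))
    (x : X) (S : Set X) : Prop :=
  ∃ f ∈ 𝒜, ∃ v, ∃ w ∈ weylGroup P, f v = x ∧ S = f '' chamber P B v w

/-- `S` is a Weyl chamber of `X`. -/
def IsChamber {P : RootPairing ι F V N} (B : Set ι) (𝒜 : Set (Model Λ P → X))
    (S : Set X) : Prop :=
  ∃ x, IsChamberAt B 𝒜 x S

/-- Axiom (A1). -/
def A1 {P : RootPairing ι F V N} (T : AddSubgroup (Model Λ P)) (𝒜 : Set (Model Λ P → X)) : Prop :=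
  ∀ f ∈ 𝒜, ∀ φ ∈ affineWeyl P T, f ∘ φ ∈ 𝒜

/-- Axiom (A2). -/
def A2 {P : RootPairing ι F V N} (T : AddSubgroup (Model Λ P))
    (d : Model Λ P → Model Λ P → Λ) (𝒜 : Set (Model Λ P → X)) : Prop :=
  ∀ f ∈ 𝒜, ∀ g ∈ 𝒜, (Set.range f ∩ Set.range g).Nonempty →
    IsClosedFor d (f ⁻¹' Set.range g) ∧ IsConvex P (f ⁻¹' Set.range g) ∧
    ∃ φ ∈ affineWeyl P T, Set.EqOn f (g ∘ φ) (f ⁻¹' Set.range g)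

/-- Axiom (A3). -/
def A3 {P : RootPairing ι F V N} (𝒜 : Set (Model Λ P → X)) : Prop :=
  ∀ x y : X, ∃ A, IsApartment 𝒜 A ∧ x ∈ A ∧ y ∈ A

/-- Axiom (A4). A sub-Weyl chamber of `S` is a Weyl chamber contained in `S`. -/
def A4 {P : RootPairing ι F V N} (B : Set ι) (𝒜 : Set (Model Λ P → X)) : Prop :=
  ∀ S T, IsChamber B 𝒜 S → IsChamber B 𝒜 T →
    ∃ S' T', IsChamber B 𝒜 S' ∧ S' ⊆ S ∧ IsChamber B 𝒜 T' ∧ T' ⊆ T ∧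
      ∃ A, IsApartment 𝒜 A ∧ S' ⊆ A ∧ T' ⊆ A

/-- The ball of radius `ε` around `x` in `X`; the distance of two points of `X` is the distance of
their preimages under a chart whose image contains both. -/
def ball {P : RootPairing ι F V N} (d : Model Λ P → Model Λ P → Λ) (𝒜 : Set (Model Λ P → X))
    (x : X) (ε : Λ) : Set X :=
  {y | ∃ f ∈ 𝒜, ∃ a b, f a = x ∧ f b = y ∧ d a b < ε}

/-- The germ at `x` of the `x`-based Weyl chamber `S` is contained in `Y`. -/
def GermSubset {P : RootPairing ι F V N} (d : Model Λ P → Model Λ P → Λ)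
    (𝒜 : Set (Model Λ P → X)) (x : X) (S Y : Set X) : Prop :=
  ∃ ε : Λ, 0 < ε ∧ S ∩ ball d 𝒜 x ε ⊆ Y

/-- The `x`-based Weyl chambers `S` and `T` share the same germ at `x`: the set `S ∩ T` is a
neighbourhood of `x` in `S` and in `T`. -/
def SameGerm {P : RootPairing ι F V N} (d : Model Λ P → Model Λ P → Λ)
    (𝒜 : Set (Model Λ P → X)) (x : X) (S T : Set X) : Prop :=
  GermSubset d 𝒜 x S (S ∩ T) ∧ GermSubset d 𝒜 x T (S ∩ T)

/-- The `x`-based Weyl chambers `S` and `T` are opposite at `x`: their germs are contained in a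
common apartment, in which they are the germs of a chamber and of its image under the longest element
of the spherical Weyl group. -/
def Opposite {P : RootPairing ι F V N} (B : Set ι) (d : Model Λ P → Model Λ P → Λ)
    (𝒜 : Set (Model Λ P → X)) (x : X) (S T : Set X) : Prop :=
  ∃ f ∈ 𝒜, ∃ v, ∃ w ∈ weylGroup P, ∃ w₀, IsLongest P B w₀ ∧ f v = x ∧
    SameGerm d 𝒜 x S (f '' chamber P B v w) ∧
    SameGerm d 𝒜 x T (f '' chamber P B v (w * w₀))

/-- Property (GG). -/
def GG {P : RootPairing ι F V N} (B : Set ι) (d : Model Λ P → Model Λ P → Λ)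
    (𝒜 : Set (Model Λ P → X)) : Prop :=
  ∀ x S T, IsChamberAt B 𝒜 x S → IsChamberAt B 𝒜 x T →
    ∃ A, IsApartment 𝒜 A ∧ GermSubset d 𝒜 x S A ∧ GermSubset d 𝒜 x T A

/-- Property (CO). -/
def CO {P : RootPairing ι F V N} (B : Set ι) (d : Model Λ P → Model Λ P → Λ)
    (𝒜 : Set (Model Λ P → X)) : Prop :=
  ∀ x S T, IsChamberAt B 𝒜 x S → IsChamberAt B 𝒜 x T → Opposite B d 𝒜 x S T →
    ∃! A, IsApartment 𝒜 A ∧ S ⊆ A ∧ T ⊆ A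

end Space

end LambdaBuilding

end

/-! Let a point s_r = f(v + w(ξ ⊗ r)) run along the regular ray of the first chamber. An apartment
which contains s_r for cofinally many r contains a subchamber: its trace in the chart f is cut out
by conditions c ≤ ⟨x, α^∨⟩, and a coroot bounded below along such a ray is positive in its direction
(`IsConvex.add_mem_of_cofinal`). It remains to let one apartment catch cofinally many s_r.

Opposition provides the candidates. Given a chamber based at s_r, the apartment of f contains a
chamber opposite to it at s_r, and by (CO) some apartment h_r contains both
(`exists_isOpp_apartment`). The opposite germ minimises (ξ, δξ) over the relative positions δ
realised by germs in the apartment of f: crossing a wall which does not separate the two germs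
lowers this value (`IsGermLink.exists_adjacent`). The opposite chamber has one of finitely many
directions, so a single direction occurs for cofinally many r. Chambers of equal direction in one
apartment share a subchamber; hence any two of these h_r have a large overlap, and convexity places
s_r in a fixed h_{r₀}.

The argument is run twice. In `exists_apartment_of_point` the chamber at s_r passes through a given
point p; the overlap contains p and a subchamber, hence the parallel chamber based at p, in which
s_r lies. In `exists_apartment_of_chambers` the chamber at s_r is parallel to a subchamber of the
second chamber; the overlap contains chambers of two opposite directions and is therefore all of
h_r. -/

noncomputable section

set_option linter.unusedSectionVars false

namespace LambdaBuilding

/-! ### The Weyl group action on roots and coroots, and the invariant form -/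

section ModelLemmas

variable {F : Subfield ℝ} {ι V N Λ : Type*}
  [AddCommGroup V] [Module F V] [AddCommGroup N] [Module F N]
  [AddCommGroup Λ] [Module F Λ]
  {P : RootPairing ι F V N} {B : Set ι}

@[simp] lemma ev_tmul (j : ι) (v : V) (r : Λ) :
    ev P j (v ⊗ₜ[F] r) = P.coroot' j v • r := by
  simp [ev]

@[simp] lemma act_tmul (w : V ≃ₗ[F] V) (v : V) (r : Λ) :
    act w (v ⊗ₜ[F] r) = w v ⊗ₜ[F] r := by
  simp [act]

lemma act_mul (w w' : V ≃ₗ[F] V) (z : V ⊗[F] Λ) : act (w * w') z = act w (act w' z) := by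
  induction z using TensorProduct.induction_on with
  | zero => simp
  | tmul v r => simp
  | add x y hx hy => simp [hx, hy]

lemma act_one (z : V ⊗[F] Λ) : act (1 : V ≃ₗ[F] V) z = z := by
  induction z using TensorProduct.induction_on with
  | zero => simp
  | tmul v r => simp
  | add x y hx hy => simp [hx, hy]

lemma act_inv_act (w : V ≃ₗ[F] V) (z : V ⊗[F] Λ) : act w⁻¹ (act w z) = z := by
  rw [← act_mul, inv_mul_cancel, act_one]

lemma act_act_inv (w : V ≃ₗ[F] V) (z : V ⊗[F] Λ) : act w (act w⁻¹ z) = z := by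
  rw [← act_mul, mul_inv_cancel, act_one]

/-- `w` carries the root and the coroot with index `k` to those with index `j`. -/
def Carries (P : RootPairing ι F V N) (w : V ≃ₗ[F] V) (k j : ι) : Prop :=
  (∀ v, P.coroot' j (w v) = P.coroot' k v) ∧ w (P.root k) = P.root j

lemma Carries.inv {w : V ≃ₗ[F] V} {j k : ι} (h : Carries P w k j) : Carries P w⁻¹ j k := by
  refine ⟨fun v => ?_, ?_⟩
  · rw [← h.1]
    congr 1
    exact w.apply_symm_apply v
  · rw [← h.2]
    exact w.symm_apply_apply _

lemma Carries.mul {w w' : V ≃ₗ[F] V} {i j k : ι} (h : Carries P w j k) (h' : Carries P w' i j) :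
    Carries P (w * w') i k :=
  ⟨fun v => by rw [LinearEquiv.mul_apply, h.1, h'.1], by rw [LinearEquiv.mul_apply, h'.2, h.2]⟩

lemma carries_reflection (i j : ι) :
    Carries P (P.reflection i) (P.reflectionPerm i j) j := by
  refine ⟨fun v => P.coroot'_reflection v, ?_⟩
  rw [← P.root_reflectionPerm]
  simp

/-- The two halves are proved in one induction because inversion interchanges them. -/
lemma exists_carries {w : V ≃ₗ[F] V} (hw : w ∈ weylGroup P) :
    (∀ j, ∃ k, Carries P w k j) ∧ ∀ k, ∃ j, Carries P w k j := by
  induction hw using Subgroup.closure_induction with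
  | mem x hx =>
    obtain ⟨i, rfl⟩ := hx
    refine ⟨fun j => ⟨_, carries_reflection i j⟩, fun k => ⟨P.reflectionPerm i k, ?_⟩⟩
    simpa using carries_reflection (P := P) i (P.reflectionPerm i k)
  | one => exact ⟨fun j => ⟨j, by simp [Carries]⟩, fun j => ⟨j, by simp [Carries]⟩⟩
  | mul x y _ _ hx hy =>
    constructor
    · intro j
      obtain ⟨k, hk⟩ := hx.1 j
      obtain ⟨l, hl⟩ := hy.1 k
      exact ⟨l, hk.mul hl⟩
    · intro j
      obtain ⟨k, hk⟩ := hy.2 j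
      obtain ⟨l, hl⟩ := hx.2 k
      exact ⟨l, hl.mul hk⟩
  | inv x _ hx =>
    constructor
    · intro j
      obtain ⟨k, hk⟩ := hx.2 j
      exact ⟨k, hk.inv⟩
    · intro j
      obtain ⟨k, hk⟩ := hx.1 j
      exact ⟨k, hk.inv⟩

lemma Carries.ev_act {w : V ≃ₗ[F] V} {j k : ι} (h : Carries P w k j) (z : V ⊗[F] Λ) :
    ev P j (act w z) = ev P k z := by
  induction z using TensorProduct.induction_on with
  | zero => simp
  | tmul v r => simp [h.1]
  | add x y hx hy => simp [hx, hy]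

lemma reflection_mem_weylGroup (i : ι) : P.reflection i ∈ weylGroup P :=
  Subgroup.subset_closure ⟨i, rfl⟩

/-- A positive definite form on `V` which is invariant under the Weyl group and induces the coroots
up to positive factors. -/
structure IsInvariantForm (P : RootPairing ι F V N) (b : LinearMap.BilinForm F V) : Prop where
  symm : ∀ x y, b x y = b y x
  invariant : ∀ w ∈ weylGroup P, ∀ x y, b (w x) (w y) = b x y
  pos : ∀ x, x ≠ 0 → 0 < b x x
  coroot : ∀ j, ∃ c : F, 0 < c ∧ ∀ v, P.coroot' j v = c * b (P.root j) v

/-- The sum of the squares of the coroots serves: it is definite because the coroots span, and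
invariance under the reflection at α forces α^∨ = 2(α, ·)/(α, α). -/
lemma exists_isInvariantForm [Finite ι] [P.IsRootSystem] :
    ∃ b : LinearMap.BilinForm F V, IsInvariantForm P b := by
  cases nonempty_fintype ι
  have hpos : ∀ x, x ≠ 0 → 0 < P.RootForm x x := by
    intro x hx
    have h1 : P.RootForm x x = ∑ i, P.coroot' i x * P.coroot' i x := by
      rw [P.rootForm_apply_apply]
    have h0 : 0 ≤ P.RootForm x x := by
      rw [h1]; exact Finset.sum_nonneg fun i _ => mul_self_nonneg _
    refine lt_of_le_of_ne h0 fun h => hx ?_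
    rw [h1, eq_comm, Finset.sum_eq_zero_iff_of_nonneg fun i _ => mul_self_nonneg _] at h
    have h2 : ∀ i, P.toLinearMap x (P.coroot i) = 0 := fun i => by
      simpa using h i (Finset.mem_univ i)
    have h3 : P.toLinearMap x = 0 := by
      apply LinearMap.ext_on_range (v := P.coroot)
      · exact RootPairing.IsRootSystem.span_coroot_eq_top
      · simpa using h2
    have := P.toPerfPair.injective (a₁ := x) (a₂ := 0)
    apply this
    ext y
    simp [h3]
  have hsymm : ∀ x y, P.RootForm x y = P.RootForm y x := fun x y => P.rootForm_symmetric.eq x y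
  have hinv : ∀ w ∈ weylGroup P, ∀ x y, P.RootForm (w x) (w y) = P.RootForm x y := by
    intro w hw
    induction hw using Subgroup.closure_induction with
    | mem x hx =>
      obtain ⟨i, rfl⟩ := hx
      exact fun x y => P.rootForm_reflection_reflection_apply i x y
    | one => simp
    | mul a b _ _ ha hb => intro x y; simp [ha, hb]
    | inv a _ ha =>
      intro x y
      rw [← ha]
      congr 1
      · congr 1; exact a.apply_symm_apply x
      · exact a.apply_symm_apply y
  refine ⟨P.RootForm, hsymm, hinv, hpos, fun j => ?_⟩
  have hj := hpos (P.root j) (P.ne_zero j)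
  refine ⟨2 / P.RootForm (P.root j) (P.root j), by positivity, fun v => ?_⟩
  have h := hinv _ (reflection_mem_weylGroup j) (P.root j) v
  rw [P.reflection_apply_self, P.reflection_apply] at h
  simp only [map_neg, map_sub, map_smul, LinearMap.neg_apply, smul_eq_mul] at h
  field_simp
  linear_combination h

instance [Finite ι] [P.IsRootSystem] : Finite (weylGroup P) := by
  have : Finite (Set.range P.root) := Set.finite_range _
  let g : weylGroup P → ι → Set.range P.root := fun w i =>
    ⟨w.1 (P.root i), by
      obtain ⟨j, hj⟩ := (exists_carries w.2).2 i
      exact ⟨j, hj.2.symm⟩⟩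
  refine Finite.of_injective g fun w w' h => ?_
  apply Subtype.ext
  apply LinearEquiv.toLinearMap_injective
  apply LinearMap.ext_on_range (v := P.root)
  · exact RootPairing.IsRootSystem.span_root_eq_top
  · intro i
    have := congrFun h i
    simpa [g] using this

end ModelLemmas

/-! ### Signs of coroots at the Weyl vector and at panel vectors -/

section Signs

variable {F : Subfield ℝ} {ι V N : Type*}
  [AddCommGroup V] [Module F V] [AddCommGroup N] [Module F N]
  {P : RootPairing ι F V N} {B : Set ι}

/-- Bases are defined through roots, chambers through coroots. Since coroots are positive multiples
of the functionals (α, ·), the form transfers nonnegative combinations from the former to the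
latter. -/
lemma coroot'_eq_sum_of_mem_rootCone [Fintype ι] {b : LinearMap.BilinForm F V}
    (hb : IsInvariantForm P b) {x : V} (h : x ∈ rootCone P B) {f : Module.Dual F V} {p : F}
    (hp : 0 < p) (hf : ∀ v, f v = p * b x v) :
    ∃ c : ι → F, (∀ i, 0 ≤ c i) ∧ (∀ i ∉ B, c i = 0) ∧ f = ∑ i, c i • P.coroot' i := by
  choose q hq hqb using hb.coroot
  obtain ⟨c, hc0, hcB, rfl⟩ := h
  refine ⟨fun i => p * c i / q i, fun i => ?_, fun i hi => by simp [hcB i hi], ?_⟩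
  · have := hq i
    have := hc0 i
    positivity
  · refine LinearMap.ext fun v => ?_
    simp only [LinearMap.smul_apply, LinearMap.sum_apply, smul_eq_mul, hf, hqb _ v]
    rw [Finsupp.sum_fintype c _ (by simp)]
    simp only [map_sum, LinearMap.sum_apply, Finset.mul_sum]
    apply Finset.sum_congr rfl
    intro i _
    have := (hq i).ne'
    simp only [map_smul, LinearMap.smul_apply, smul_eq_mul]
    field_simp

lemma IsRootBasis.exists_coroot'_eq [Fintype ι] [P.IsRootSystem] (hB : IsRootBasis P B) (j : ι) :
    ∃ c : ι → F, (∀ i, 0 ≤ c i) ∧ (∀ i ∉ B, c i = 0) ∧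
      (P.coroot' j = ∑ i, c i • P.coroot' i ∨ P.coroot' j = -∑ i, c i • P.coroot' i) := by
  obtain ⟨b, hb⟩ := exists_isInvariantForm (P := P)
  obtain ⟨p, hp, hpb⟩ := hb.coroot j
  rcases hB.pos_or_neg j with h | h
  · obtain ⟨c, h1, h2, h3⟩ := coroot'_eq_sum_of_mem_rootCone hb h hp hpb
    exact ⟨c, h1, h2, Or.inl h3⟩
  · obtain ⟨c, h1, h2, h3⟩ := coroot'_eq_sum_of_mem_rootCone hb h (f := -P.coroot' j) hp
      fun v => by rw [LinearMap.neg_apply, hpb, map_neg, LinearMap.neg_apply, mul_neg]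
    exact ⟨c, h1, h2, Or.inr (by rw [← h3, neg_neg])⟩

lemma IsRootBasis.exists_coroot'_apply_eq [Finite ι] [P.IsRootSystem] (hB : IsRootBasis P B)
    (g : ι → F) : ∃ v, ∀ i ∈ B, P.coroot' i v = g i := by
  classical
  cases nonempty_fintype ι
  obtain ⟨b, hb⟩ := exists_isInvariantForm (P := P)
  have hspan : ⊤ ≤ Submodule.span F (Set.range fun i : B => P.root i) := by
    rw [← RootPairing.IsRootSystem.span_root_eq_top (P := P), Submodule.span_le]
    have hcone : ∀ v ∈ rootCone P B, v ∈ Submodule.span F (Set.range fun i : B => P.root i) := by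
      rintro v ⟨c, -, hc, rfl⟩
      refine Submodule.sum_mem _ fun i _ => ?_
      by_cases hi : i ∈ B
      · exact Submodule.smul_mem _ _ (Submodule.subset_span ⟨⟨i, hi⟩, rfl⟩)
      · simp [hc i hi]
    rintro _ ⟨i, rfl⟩
    rcases hB.pos_or_neg i with h | h
    · exact hcone _ h
    · simpa using hcone _ h
  let e : Module.Basis B F V := Module.Basis.mk hB.linearIndepOn hspan
  have : FiniteDimensional F V := e.finiteDimensional_of_finite
  let L : V →ₗ[F] (B → F) := LinearMap.pi fun i => P.coroot' i
  -- A vector killed by all simple coroots is orthogonal to a basis of `V`, hence zero by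
  -- definiteness.
  have hL : Function.Injective L := by
    rw [injective_iff_map_eq_zero]
    intro v hv
    by_contra hne
    refine (hb.pos v hne).ne' ?_
    have h0 : b.flip v = 0 := by
      refine e.ext fun i => ?_
      obtain ⟨c, hc, hcb⟩ := hb.coroot i
      have h1 : P.coroot' i v = 0 := congrFun hv i
      rw [hcb] at h1
      have h2 : e i = P.root i := Module.Basis.mk_apply _ _ i
      rw [h2]
      exact (mul_eq_zero.1 h1).resolve_left hc.ne'
    exact congrArg (fun l => l v) h0
  have hdim : Module.finrank F V = Module.finrank F (B → F) := by
    rw [Module.finrank_eq_card_basis e, Module.finrank_fintype_fun_eq_card]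
  obtain ⟨v, hv⟩ := (LinearMap.injective_iff_surjective_of_finrank_eq_finrank hdim).1 hL
    fun i => g i
  exact ⟨v, fun i hi => congrFun hv ⟨i, hi⟩⟩

/-- `ξ` is the point of the fundamental chamber at which all simple coroots take the value `1`. -/
def IsWeylVector (P : RootPairing ι F V N) (B : Set ι) (ξ : V) : Prop :=
  ∀ i ∈ B, P.coroot' i ξ = 1

/-- `μ` is the point of the `i`-th panel of the fundamental chamber at which all simple coroots other
than the `i`-th one take the value `1`. -/
def IsPanelVector (P : RootPairing ι F V N) (B : Set ι) (i : ι) (μ : V) : Prop :=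
  P.coroot' i μ = 0 ∧ ∀ j ∈ B, j ≠ i → P.coroot' j μ = 1

lemma IsRootBasis.exists_isWeylVector [Finite ι] [P.IsRootSystem] (hB : IsRootBasis P B) :
    ∃ ξ, IsWeylVector P B ξ :=
  hB.exists_coroot'_apply_eq fun _ => 1

lemma IsRootBasis.exists_isPanelVector [Finite ι] [P.IsRootSystem] (hB : IsRootBasis P B)
    {i : ι} (hi : i ∈ B) : ∃ μ, IsPanelVector P B i μ := by
  classical
  obtain ⟨μ, hμ⟩ := hB.exists_coroot'_apply_eq fun j => if j = i then 0 else 1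
  exact ⟨μ, by simpa using hμ i hi, fun j hj hji => by simpa [hji] using hμ j hj⟩

lemma coroot'_ne_zero (j : ι) : P.coroot' j ≠ 0 := by
  intro h
  have : P.coroot' j (P.root j) = 2 := P.root_coroot'_eq_pairing j j ▸ P.pairing_same j
  rw [h] at this
  simp at this

variable {ξ : V} (hξ : IsWeylVector P B ξ)
include hξ

lemma IsWeylVector.sum_apply [Fintype ι] {c : ι → F} (hcB : ∀ i ∉ B, c i = 0) :
    (∑ i, c i • P.coroot' i) ξ = ∑ i, c i := by
  simp only [LinearMap.sum_apply, LinearMap.smul_apply, smul_eq_mul]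
  refine Finset.sum_congr rfl fun i _ => ?_
  by_cases hi : i ∈ B
  · rw [hξ i hi, mul_one]
  · rw [hcB i hi, zero_mul]

/-- Every coroot is a combination of the simple coroots with coefficients which have the sign of its
value at the Weyl vector. -/
lemma IsWeylVector.exists_coroot'_eq [Fintype ι] [P.IsRootSystem] (hB : IsRootBasis P B) (j : ι) :
    ∃ c : ι → F, (∀ i, 0 ≤ c i) ∧ (∀ i ∉ B, c i = 0) ∧
      (0 < P.coroot' j ξ ∧ P.coroot' j = ∑ i, c i • P.coroot' i ∨
        P.coroot' j ξ < 0 ∧ P.coroot' j = -∑ i, c i • P.coroot' i) := by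
  obtain ⟨c, hc0, hcB, hc⟩ := hB.exists_coroot'_eq j
  have hs := hξ.sum_apply hcB
  have hpos : 0 < ∑ i, c i := by
    refine lt_of_le_of_ne (Finset.sum_nonneg fun i _ => hc0 i) fun h => coroot'_ne_zero (P := P) j ?_
    rw [eq_comm, Finset.sum_eq_zero_iff_of_nonneg fun i _ => hc0 i] at h
    have h0 : ∑ i, c i • P.coroot' i = 0 :=
      Finset.sum_eq_zero fun i hi => by rw [h i hi, zero_smul]
    rcases hc with hc | hc <;> simp [hc, h0]
  refine ⟨c, hc0, hcB, ?_⟩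
  rcases hc with hc | hc
  · left
    exact ⟨by rw [hc, hs]; exact hpos, hc⟩
  · right
    exact ⟨by rw [hc, LinearMap.neg_apply, hs]; linarith, hc⟩

lemma IsWeylVector.coroot'_ne_zero [Finite ι] [P.IsRootSystem] (hB : IsRootBasis P B) (j : ι) :
    P.coroot' j ξ ≠ 0 := by
  cases nonempty_fintype ι
  obtain ⟨c, -, -, h | h⟩ := hξ.exists_coroot'_eq hB j
  · exact h.1.ne'
  · exact h.1.ne

/-- A negative coroot vanishes at `μ` only if every simple coroot other than the `i`-th has
coefficient zero in it. -/
lemma IsWeylVector.coroot'_panel [Finite ι] [P.IsRootSystem] (hB : IsRootBasis P B) {i j : ι}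
    {μ : V} (hμ : IsPanelVector P B i μ) (hj : P.coroot' j ξ < 0) :
    P.coroot' j μ < 0 ∨ ∃ c : F, 0 < c ∧ P.coroot' j = -(c • P.coroot' i) := by
  cases nonempty_fintype ι
  obtain ⟨c, hc0, hcB, h | h⟩ := hξ.exists_coroot'_eq hB j
  · exact absurd h.1 hj.not_gt
  · have hnn : ∀ k, 0 ≤ c k * P.coroot' k μ := by
      intro k
      by_cases hk : k ∈ B
      · by_cases hki : k = i
        · rw [hki, hμ.1, mul_zero]
        · rw [hμ.2 k hk hki, mul_one]; exact hc0 k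
      · rw [hcB k hk, zero_mul]
    have hμj : P.coroot' j μ = -∑ k, c k * P.coroot' k μ := by
      rw [h.2]; simp
    by_cases hlt : P.coroot' j μ < 0
    · exact Or.inl hlt
    right
    have h0 : ∑ k, c k * P.coroot' k μ = 0 :=
      le_antisymm (by linarith) (Finset.sum_nonneg fun k _ => hnn k)
    rw [Finset.sum_eq_zero_iff_of_nonneg fun k _ => hnn k] at h0
    have hck : ∀ k, k ≠ i → c k = 0 := by
      intro k hki
      by_cases hk : k ∈ B
      · simpa [hμ.2 k hk hki] using h0 k (Finset.mem_univ k)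
      · exact hcB k hk
    have hj' : P.coroot' j = -(c i • P.coroot' i) := by
      rw [h.2, Finset.sum_eq_single i (fun k _ hki => by rw [hck k hki, zero_smul]) (by simp)]
    refine ⟨c i, lt_of_le_of_ne (hc0 i) fun h => LambdaBuilding.coroot'_ne_zero (P := P) j ?_, hj'⟩
    rw [hj', ← h, zero_smul, neg_zero]

/-- The directions of the chambers `k₁ C` and `k₂ C` are opposite, where `ξ` is the Weyl vector. -/
def IsOpp (P : RootPairing ι F V N) (ξ : V) (k₁ k₂ : V ≃ₗ[F] V) : Prop :=
  ∀ j, P.coroot' j (k₁ ξ) * P.coroot' j (k₂ ξ) < 0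

omit hξ in
lemma IsOpp.mul_left {k₁ k₂ u : V ≃ₗ[F] V} (hu : u ∈ weylGroup P) (h : IsOpp P ξ k₁ k₂) :
    IsOpp P ξ (u * k₁) (u * k₂) := by
  intro j
  obtain ⟨k, hk⟩ := (exists_carries hu).1 j
  simp only [LinearEquiv.mul_apply, hk.1]
  exact h k

/-- If `u` carries a simple root to the root `k`, then the coroot `k` takes the value 1 at `u ξ`, so
by opposition it is negative at `ξ`. -/
lemma IsOpp.isLongest [Finite ι] [P.IsRootSystem] (hB : IsRootBasis P B) {u : V ≃ₗ[F] V}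
    (hu : u ∈ weylGroup P) (h : IsOpp P ξ 1 u) : IsLongest P B u := by
  cases nonempty_fintype ι
  refine ⟨hu, fun i hi => ?_⟩
  obtain ⟨k, hk⟩ := (exists_carries hu).2 i
  rw [hk.2]
  refine (hB.pos_or_neg k).resolve_left fun hk' => ?_
  obtain ⟨b, hb⟩ := exists_isInvariantForm (P := P)
  obtain ⟨p, hp, hpb⟩ := hb.coroot k
  obtain ⟨c, hc0, hcB, hc⟩ := coroot'_eq_sum_of_mem_rootCone hb hk' hp hpb
  have h1 : 0 ≤ P.coroot' k ξ := by
    rw [hc, hξ.sum_apply hcB]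
    exact Finset.sum_nonneg fun i _ => hc0 i
  have h2 := h k
  rw [hk.1, hξ i hi, mul_one] at h2
  exact h1.not_gt h2

end Signs

/-! ### Chambers of the model space over Λ -/

section Chambers

variable {F : Subfield ℝ} {ι V N Λ : Type*}
  [AddCommGroup V] [Module F V] [AddCommGroup N] [Module F N]
  [AddCommGroup Λ] [LinearOrder Λ] [IsOrderedAddMonoid Λ] [Module F Λ] [IsStrictOrderedModule F Λ]
  {P : RootPairing ι F V N} {B : Set ι} {ξ : V}

omit [LinearOrder Λ] [IsOrderedAddMonoid Λ] [IsStrictOrderedModule F Λ] in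
lemma ev_eq_sum [Fintype ι] {c : ι → F} {j : ι} (h : P.coroot' j = ∑ i, c i • P.coroot' i)
    (z : Model Λ P) : ev P j z = ∑ i, c i • ev P i z := by
  induction z using TensorProduct.induction_on with
  | zero => simp
  | tmul v r =>
    simp only [ev_tmul]
    rw [h, LinearMap.sum_apply, Finset.sum_smul]
    exact Finset.sum_congr rfl fun i _ => by
      rw [LinearMap.smul_apply, smul_eq_mul, mul_smul]
  | add x y hx hy =>
    simp only [map_add, hx, hy, smul_add, Finset.sum_add_distrib]

omit [IsOrderedAddMonoid Λ] [IsStrictOrderedModule F Λ] in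
lemma zero_mem_fundChamber : (0 : Model Λ P) ∈ fundChamber P B := fun i _ => by
  rw [map_zero]

omit [IsStrictOrderedModule F Λ] in
lemma add_mem_fundChamber {x y : Model Λ P} (hx : x ∈ fundChamber P B)
    (hy : y ∈ fundChamber P B) : x + y ∈ fundChamber P B := fun i hi => by
  rw [map_add]
  exact add_nonneg (hx i hi) (hy i hi)

lemma tmul_mem_fundChamber {ζ : V} (hζ : ∀ i ∈ B, 0 ≤ P.coroot' i ζ) {r : Λ} (hr : 0 ≤ r) :
    (ζ ⊗ₜ[F] r : Model Λ P) ∈ fundChamber P B := fun i hi => by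
  rw [ev_tmul]
  exact smul_nonneg (hζ i hi) hr

lemma IsWeylVector.nonneg (hξ : IsWeylVector P B ξ) : ∀ i ∈ B, 0 ≤ P.coroot' i ξ := fun i hi => by
  rw [hξ i hi]; exact zero_le_one

lemma IsPanelVector.nonneg {μ : V} {i : ι} (hμ : IsPanelVector P B i μ) :
    ∀ j ∈ B, 0 ≤ P.coroot' j μ := fun j hj => by
  by_cases hji : j = i
  · rw [hji, hμ.1]
  · rw [hμ.2 j hj hji]; exact zero_le_one

section Sign

variable [Finite ι] [P.IsRootSystem] (hB : IsRootBasis P B) (hξ : IsWeylVector P B ξ)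
include hB hξ

lemma ev_nonneg_of_mem {j : ι} (hj : 0 < P.coroot' j ξ) {z : Model Λ P}
    (hz : z ∈ fundChamber P B) : 0 ≤ ev P j z := by
  cases nonempty_fintype ι
  obtain ⟨c, hc0, hcB, h | h⟩ := hξ.exists_coroot'_eq hB j
  · rw [ev_eq_sum h.2]
    refine Finset.sum_nonneg fun i _ => ?_
    by_cases hi : i ∈ B
    · exact smul_nonneg (hc0 i) (hz i hi)
    · rw [hcB i hi, zero_smul]
  · exact absurd h.1 hj.not_gt

lemma ev_nonpos_of_mem {j : ι} (hj : P.coroot' j ξ < 0) {z : Model Λ P}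
    (hz : z ∈ fundChamber P B) : ev P j z ≤ 0 := by
  cases nonempty_fintype ι
  obtain ⟨c, hc0, hcB, h | h⟩ := hξ.exists_coroot'_eq hB j
  · exact absurd h.1 hj.not_gt
  · have h' : P.coroot' j = ∑ i, (-c i) • P.coroot' i := by
      refine LinearMap.ext fun v => ?_
      rw [h.2]
      simp only [LinearMap.neg_apply, LinearMap.sum_apply, LinearMap.smul_apply, smul_eq_mul,
        neg_mul, Finset.sum_neg_distrib]
    rw [ev_eq_sum h']
    refine Finset.sum_nonpos fun i _ => ?_
    by_cases hi : i ∈ B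
    · rw [neg_smul, neg_nonpos]
      exact smul_nonneg (hc0 i) (hz i hi)
    · rw [hcB i hi, neg_zero, zero_smul]

/-- Every point of the model space lies in a chamber based at the origin. -/
lemma exists_act_eq (z : Model Λ P) :
    ∃ w ∈ weylGroup P, ∃ y ∈ fundChamber P B, act w y = z := by
  obtain ⟨b, hb⟩ := exists_isInvariantForm (P := P)
  -- The Λ-valued height (ξ, ·) increases under a simple reflection whose coroot is negative at the
  -- point, so its maximum on the finite orbit is attained in the fundamental chamber.
  let h : V ⊗[F] Λ →ₗ[F] Λ := (TensorProduct.lid F Λ).toLinearMap ∘ₗ LinearMap.rTensor Λ (b ξ)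
  have hh : ∀ i (y : V ⊗[F] Λ), h (act (P.reflection i) y) = h y - b ξ (P.root i) • ev P i y := by
    intro i y
    induction y using TensorProduct.induction_on with
    | zero => simp
    | tmul v r =>
      simp only [h, act_tmul, ev_tmul, LinearMap.comp_apply, LinearMap.rTensor_tmul,
        LinearEquiv.coe_coe, TensorProduct.lid_tmul, P.reflection_apply, map_sub, map_smul,
        smul_eq_mul, sub_smul, mul_smul]
      rw [smul_comm]
    | add x y hx hy =>
      simp only [map_add, hx, hy, smul_add]
      abel
  obtain ⟨⟨w, hw⟩, hmax⟩ := Finite.exists_max fun w : weylGroup P => h (act w.1 z)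
  refine ⟨w⁻¹, inv_mem hw, act w z, fun i hi => ?_, act_inv_act w z⟩
  by_contra hneg
  rw [not_le] at hneg
  have h1 := hmax ⟨P.reflection i * w, mul_mem (reflection_mem_weylGroup i) hw⟩
  simp only [act_mul, hh] at h1
  obtain ⟨c, hc, hcb⟩ := hb.coroot i
  have h2 := hcb ξ
  rw [hξ i hi, hb.symm] at h2
  have h3 : 0 < b ξ (P.root i) := by
    by_contra h
    rw [not_lt] at h
    have := mul_nonpos_of_nonneg_of_nonpos hc.le h
    rw [← h2] at this
    exact absurd zero_lt_one this.not_gt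
  have h4 := smul_neg_of_pos_of_neg h3 hneg
  rw [sub_le_self_iff] at h1
  exact h1.not_gt h4

/-- Opposite directions satisfy k₂C = -k₁C: a coroot which is simple for k₂C is negative on k₁C. -/
lemma IsOpp.exists_act_eq_neg {k₁ k₂ : V ≃ₗ[F] V} (h : IsOpp P ξ k₁ k₂) (hk₁ : k₁ ∈ weylGroup P)
    (hk₂ : k₂ ∈ weylGroup P) {z : Model Λ P} (hz : z ∈ fundChamber P B) :
    ∃ z' ∈ fundChamber P B, act k₂ z' = -act k₁ z := by
  refine ⟨act k₂⁻¹ (-act k₁ z), fun i hi => ?_, act_act_inv _ _⟩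
  obtain ⟨j, hj⟩ := (exists_carries hk₂).2 i
  obtain ⟨l, hl⟩ := (exists_carries hk₁).1 j
  rw [hj.inv.ev_act, map_neg, hl.ev_act, neg_nonneg]
  apply ev_nonpos_of_mem hB hξ _ hz
  have h1 := h j
  rwa [hl.1, hj.1, hξ i hi, mul_one] at h1

end Sign

lemma exists_mem_add_mem_fundChamber [Finite ι] (hξ : IsWeylVector P B ξ) (x : Model Λ P) :
    ∃ z ∈ fundChamber P B, z + x ∈ fundChamber P B := by
  obtain ⟨M, hM⟩ := Finite.exists_le fun o : Option ι => o.elim 0 fun i => -ev P i x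
  refine ⟨ξ ⊗ₜ[F] M, tmul_mem_fundChamber hξ.nonneg (hM none), fun i hi => ?_⟩
  rw [map_add, ev_tmul, hξ i hi, one_smul]
  have : -ev P i x ≤ M := hM (some i)
  exact neg_le_iff_add_nonneg.1 this

/-- Parallel chambers share a subchamber; the common point is its apex. -/
lemma exists_add_act_eq [Finite ι] (hξ : IsWeylVector P B ξ) (v v' : Model Λ P)
    (u : V ≃ₗ[F] V) :
    ∃ z ∈ fundChamber P B, ∃ z' ∈ fundChamber P B, v + act u z = v' + act u z' := by
  obtain ⟨z, hz, hz'⟩ := exists_mem_add_mem_fundChamber hξ (act u⁻¹ (v - v'))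
  refine ⟨z, hz, _, hz', ?_⟩
  rw [map_add, act_act_inv]
  abel

omit [IsOrderedAddMonoid Λ] [IsStrictOrderedModule F Λ] in
lemma exists_forall_le_of_finite {κ : Type*} [Finite κ] {ε : Λ} (hε : 0 < ε) {f : κ → Λ}
    (hf : ∀ i, 0 < f i) : ∃ η, 0 < η ∧ ∀ i, η ≤ f i := by
  have : Nonempty {x : Λ // 0 < x} := ⟨⟨ε, hε⟩⟩
  obtain ⟨⟨η, hη⟩, h⟩ := Finite.exists_ge fun i => (⟨f i, hf i⟩ : {x : Λ // 0 < x})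
  exact ⟨η, hη, h⟩

lemma exists_abs_ev_tmul_lt [Finite ι] (ζ : V) {η : Λ} (hη : 0 < η) :
    ∃ r : Λ, 0 < r ∧ ∀ i, |ev P i (ζ ⊗ₜ[F] r)| < η := by
  -- The extra value 0 at `none` forces `M ≥ 0`, so that `M + 1` is invertible and a strict bound.
  obtain ⟨M, hM⟩ := Finite.exists_le fun o : Option ι => o.elim 0 fun i => |P.coroot' i ζ|
  have hM0 : 0 ≤ M := hM none
  have hM1 : 0 < M + 1 := by linarith
  have hr : 0 < (M + 1)⁻¹ • η := smul_pos (inv_pos.2 hM1) hη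
  refine ⟨(M + 1)⁻¹ • η, hr, fun i => ?_⟩
  have hi : |P.coroot' i ζ| ≤ M := hM (some i)
  rw [ev_tmul, abs_smul, abs_of_pos hr]
  calc |P.coroot' i ζ| • (M + 1)⁻¹ • η < (M + 1) • (M + 1)⁻¹ • η :=
        smul_lt_smul_of_pos_right (by linarith) hr
    _ = η := smul_inv_smul₀ hM1.ne' η

lemma exists_forall_coroot'_nonneg [Finite ι] (hξ : IsWeylVector P B ξ) (ζ : V) :
    ∃ M : F, ∀ i ∈ B, 0 ≤ P.coroot' i (ζ + M • ξ) := by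
  obtain ⟨M, hM⟩ := Finite.exists_le fun i => -P.coroot' i ζ
  refine ⟨M, fun i hi => ?_⟩
  rw [map_add, map_smul, hξ i hi, smul_eq_mul, mul_one]
  have := hM i
  linarith

omit [IsOrderedAddMonoid Λ] in
lemma tmul_right_injective [Finite ι] [P.IsRootSystem] {x y : V} {r : Λ} (hr : 0 < r)
    (h : x ⊗ₜ[F] r = y ⊗ₜ[F] r) : x = y := by
  obtain ⟨b, hb⟩ := exists_isInvariantForm (P := P)
  have h0 : ∀ j, P.coroot' j (x - y) = 0 := by
    intro j
    have := congrArg (ev P j) h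
    rw [ev_tmul, ev_tmul, ← sub_eq_zero, ← sub_smul, ← map_sub] at this
    exact (smul_eq_zero.1 this).resolve_right hr.ne'
  by_contra hne
  refine (hb.pos (x - y) (sub_ne_zero.2 hne)).ne' ?_
  have : b.flip (x - y) = 0 := by
    apply LinearMap.ext_on_range (v := P.root)
    · exact RootPairing.IsRootSystem.span_root_eq_top
    · intro j
      obtain ⟨c, hc, hcb⟩ := hb.coroot j
      have := h0 j
      rw [hcb] at this
      exact (mul_eq_zero.1 this).resolve_left hc.ne'
  exact congrArg (fun l => l (x - y)) this

/-- A linear map is determined by its values on the germ of a chamber. -/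
lemma eq_of_eqOn_germ [Finite ι] [P.IsRootSystem] (hξ : IsWeylVector P B ξ) {k₁ k₂ : V ≃ₗ[F] V}
    {η : Λ} (hη : 0 < η) (h : ∀ z ∈ fundChamber (Λ := Λ) P B, (∀ i, |ev P i z| < η) →
      act k₁ z = act k₂ z) : k₁ = k₂ := by
  have key : ∀ ζ : V, (∀ i ∈ B, 0 ≤ P.coroot' i ζ) → k₁ ζ = k₂ ζ := by
    intro ζ hζ
    obtain ⟨r, hr, hr'⟩ := exists_abs_ev_tmul_lt (P := P) ζ hη
    have := h _ (tmul_mem_fundChamber hζ hr.le) hr'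
    rw [act_tmul, act_tmul] at this
    exact tmul_right_injective (P := P) hr this
  ext ζ
  -- Every vector is a difference of two vectors of the closed fundamental cone, where the maps
  -- agree.
  obtain ⟨M, hM⟩ := exists_forall_coroot'_nonneg hξ ζ
  have h1 := key _ hM
  have h2 := key ξ hξ.nonneg
  simpa [h2] using h1

/-! ### Convex sets, cofinal rays and germs -/

section Convexity

omit [IsStrictOrderedModule F Λ] in
lemma IsHalfApartment.exists_eq {H : Set (Model Λ P)} (h : IsHalfApartment P H) :
    ∃ j, ∃ c : Λ, H = {x | c ≤ ev P j x} := by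
  obtain ⟨_, ⟨w, hw, t, -, rfl⟩, i, rfl⟩ := h
  obtain ⟨j, hj⟩ := (exists_carries hw).2 i
  refine ⟨j, ev P j t, Set.ext fun x => ⟨?_, fun hx => ?_⟩⟩
  · rintro ⟨y, hy, rfl⟩
    simpa [hj.ev_act] using hy
  · refine ⟨act w⁻¹ (x - t), ?_, by simp [act_act_inv]⟩
    simpa [hj.inv.ev_act] using hx

omit [IsStrictOrderedModule F Λ] in
lemma IsConvex.mem {Y : Set (Model Λ P)} (hY : IsConvex P Y) {x : Model Λ P}
    (h : ∀ j, ∀ c : Λ, (∀ y ∈ Y, c ≤ ev P j y) → c ≤ ev P j x) : x ∈ Y := by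
  obtain ⟨𝓗, h𝓗, rfl⟩ := hY
  intro H hH
  obtain ⟨j, c, rfl⟩ := (h𝓗 H hH).exists_eq
  exact h j c fun y hy => hy _ hH

/-- A set is cofinal in `Λ` if every element of `Λ` is bounded above by one of its elements. -/
def Cofinal (R : Set Λ) : Prop := ∀ r, ∃ r' ∈ R, r ≤ r'

/-- With negative slope the bound would fail beyond e⁻¹(c - a); adding `ε` passes this threshold
strictly. -/
lemma Cofinal.pos_of_le {R : Set Λ} (hR : Cofinal R) {ε : Λ} (hε : 0 < ε) {e : F} (he : e ≠ 0)
    {a c : Λ} (h : ∀ r ∈ R, c ≤ a + e • r) : 0 < e := by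
  by_contra hneg
  have he' : e < 0 := lt_of_le_of_ne (not_lt.1 hneg) he
  obtain ⟨r, hr, hle⟩ := hR (e⁻¹ • (c - a) + ε)
  have h1 := h r hr
  have h2 : e⁻¹ • (c - a) < r := lt_of_lt_of_le (lt_add_of_pos_right _ hε) hle
  have h3 := smul_lt_smul_of_neg_left h2 he'
  rw [smul_inv_smul₀ he] at h3
  rw [← sub_le_iff_le_add'] at h1
  exact h1.not_gt h3

omit [LinearOrder Λ] [IsOrderedAddMonoid Λ] [IsStrictOrderedModule F Λ] in
lemma Carries.ev_add_act_tmul {k : V ≃ₗ[F] V} {j l : ι} (h : Carries P k l j) (v : Model Λ P)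
    (r : Λ) : ev P j (v + act k (ξ ⊗ₜ[F] r)) = ev P j v + P.coroot' l ξ • r := by
  rw [map_add, h.ev_act, ev_tmul]

variable [Finite ι] [P.IsRootSystem] (hB : IsRootBasis P B) (hξ : IsWeylVector P B ξ)
  {ε : Λ} (hε : 0 < ε) {Y : Set (Model Λ P)} (hY : IsConvex P Y)
include hB hξ hY

section

include hε

/-- Any half-apartment containing `Y` is bounded by a coroot that is bounded below on a cofinal part
of the ray, hence positive in its regular direction; so adding `act k z` never leaves it. -/
lemma IsConvex.add_mem_of_cofinal {v : Model Λ P} {k : V ≃ₗ[F] V} (hk : k ∈ weylGroup P)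
    {R : Set Λ} (hR : Cofinal R) (h : ∀ r ∈ R, v + act k (ξ ⊗ₜ[F] r) ∈ Y) {q : Model Λ P}
    (hq : q ∈ Y) {z : Model Λ P} (hz : z ∈ fundChamber P B) : q + act k z ∈ Y := by
  refine hY.mem fun j c hc => ?_
  obtain ⟨l, hl⟩ := (exists_carries hk).1 j
  have hpos : 0 < P.coroot' l ξ :=
    hR.pos_of_le hε (hξ.coroot'_ne_zero hB l) (a := ev P j v) (c := c) fun r hr => by
      rw [← hl.ev_add_act_tmul]
      exact hc _ (h r hr)
  rw [map_add, hl.ev_act]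
  exact (hc q hq).trans (le_add_of_nonneg_right (ev_nonneg_of_mem hB hξ hpos hz))

omit hB hξ hY hε [Finite ι] [P.IsRootSystem] in
lemma cofinal_Ici : Cofinal (Set.Ici (0 : Λ)) := fun r => ⟨max r 0, le_max_right _ _, le_max_left _ _⟩

lemma IsConvex.add_mem_of_chamber {v : Model Λ P} {k : V ≃ₗ[F] V} (hk : k ∈ weylGroup P)
    (h : ∀ z ∈ fundChamber P B, v + act k z ∈ Y) {q : Model Λ P}
    (hq : q ∈ Y) {z : Model Λ P} (hz : z ∈ fundChamber P B) : q + act k z ∈ Y :=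
  hY.add_mem_of_cofinal hB hξ hε hk cofinal_Ici
    (fun _ hr => h _ (tmul_mem_fundChamber hξ.nonneg hr)) hq hz

/-- A coroot bounded below on `Y` would be positive in both of two opposite directions, so no
half-apartment contains `Y`. -/
lemma IsConvex.mem_of_isOpp {v₁ v₂ : Model Λ P} {k₁ k₂ : V ≃ₗ[F] V} (hk₁ : k₁ ∈ weylGroup P)
    (hk₂ : k₂ ∈ weylGroup P) (hopp : IsOpp P ξ k₁ k₂)
    (h₁ : ∀ z ∈ fundChamber P B, v₁ + act k₁ z ∈ Y)
    (h₂ : ∀ z ∈ fundChamber P B, v₂ + act k₂ z ∈ Y) (x : Model Λ P) : x ∈ Y := by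
  refine hY.mem fun j c hc => ?_
  have key : ∀ {v : Model Λ P} {k : V ≃ₗ[F] V}, k ∈ weylGroup P →
      (∀ z ∈ fundChamber P B, v + act k z ∈ Y) → 0 < P.coroot' j (k ξ) := by
    intro v k hk h
    obtain ⟨l, hl⟩ := (exists_carries hk).1 j
    rw [hl.1]
    refine cofinal_Ici.pos_of_le hε (hξ.coroot'_ne_zero hB l) (a := ev P j v) (c := c)
      fun r hr => ?_
    rw [← hl.ev_add_act_tmul]
    exact hc _ (h _ (tmul_mem_fundChamber hξ.nonneg hr))
  exact absurd (mul_pos (key hk₁ h₁) (key hk₂ h₂)) (hopp j).not_gt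

end

/-- If a convex set contains the germ of the chamber of direction `a C` and the germ of a panel of the
chamber of direction `k C` whose wall does not separate these two chambers, then it contains the
germ of the latter. -/
lemma IsConvex.exists_germ_mem {v : Model Λ P} {a k : V ≃ₗ[F] V} (hk : k ∈ weylGroup P) {i : ι}
    {μ : V} (hμ : IsPanelVector P B i μ) (hv : v ∈ Y) {r₁ r₂ : Λ}
    (hr₁ : 0 < r₁) (h₁ : v + act a (ξ ⊗ₜ[F] r₁) ∈ Y) (hr₂ : 0 < r₂)
    (h₂ : v + act k (μ ⊗ₜ[F] r₂) ∈ Y) (hpos : 0 < P.coroot' i (k⁻¹ (a ξ))) :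
    ∃ η : Λ, 0 < η ∧ ∀ z ∈ fundChamber P B, (∀ i, |ev P i z| < η) → v + act k z ∈ Y := by
  have key : ∀ j, ∃ η : Λ, 0 < η ∧ ∀ z ∈ fundChamber P B, (∀ i, |ev P i z| < η) →
      ∀ c : Λ, (∀ y ∈ Y, c ≤ ev P j y) → c ≤ ev P j (v + act k z) := by
    intro j
    obtain ⟨l, hl⟩ := (exists_carries hk).1 j
    -- A point of `Y` at which the coroot is smaller than at `v` leaves the margin `(-e) • r` at
    -- `v`, which a small germ cannot exhaust.
    have aux : ∀ {e : F} {r : Λ} {y : Model Λ P}, e < 0 → 0 < r → y ∈ Y →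
        ev P j y = ev P j v + e • r →
        ∃ η : Λ, 0 < η ∧ ∀ z ∈ fundChamber P B, (∀ i, |ev P i z| < η) →
      ∀ c : Λ, (∀ y ∈ Y, c ≤ ev P j y) → c ≤ ev P j (v + act k z) := by
      intro e r y he hr hy hjy
      refine ⟨(-e) • r, smul_pos (neg_pos.2 he) hr, fun z _ hz c hc => (hc y hy).trans ?_⟩
      rw [hjy, map_add, hl.ev_act]
      have := (abs_lt.1 (hz l)).1
      rw [neg_smul, neg_neg] at this
      exact add_le_add_right this.le _
    -- A coroot decreasing in direction `k` gets its margin from the panel point, unless it is the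
    -- wall of the panel itself; then it also decreases in direction `a`, which lies on the same
    -- side, and the point in that direction gives the margin.
    rcases (hξ.coroot'_ne_zero hB l).lt_or_gt with hneg | hlpos
    · rcases hξ.coroot'_panel hB hμ hneg with h | ⟨c, hc, h⟩
      · refine aux h hr₂ h₂ ?_
        rw [map_add, hl.ev_act, ev_tmul]
      · have h3 : P.coroot' j (a ξ) < 0 := by
          have h4 := hl.1 (k⁻¹ (a ξ))
          have h5 : k (k⁻¹ (a ξ)) = a ξ := k.apply_symm_apply _
          rw [h5] at h4
          rw [h4, h, LinearMap.neg_apply, LinearMap.smul_apply, smul_eq_mul, neg_lt_zero]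
          exact mul_pos hc hpos
        refine aux h3 hr₁ h₁ ?_
        rw [map_add, act_tmul, ev_tmul]
    · refine ⟨r₁, hr₁, fun z hz _ c hc => (hc v hv).trans ?_⟩
      rw [map_add, hl.ev_act]
      exact le_add_of_nonneg_right (ev_nonneg_of_mem hB hξ hlpos hz)
  choose f hf hfY using key
  obtain ⟨η, hη, hle⟩ := exists_forall_le_of_finite hr₁ hf
  exact ⟨η, hη, fun z hz hzη => hY.mem fun j c hc =>
    hfY j z hz (fun i => (hzη i).trans_le (hle j)) c hc⟩

end Convexity

end Chambers

/-! ### Transition maps between charts and germs of chambers -/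

section Germs

variable {F : Subfield ℝ} {ι V N Λ X : Type*}
  [AddCommGroup V] [Module F V] [AddCommGroup N] [Module F N]
  [AddCommGroup Λ] [LinearOrder Λ] [IsOrderedAddMonoid Λ] [Module F Λ] [IsStrictOrderedModule F Λ]
  {P : RootPairing ι F V N} {B : Set ι} {ξ : V} {T : AddSubgroup (Model Λ P)}
  {d : Model Λ P → Model Λ P → Λ} {𝒜 : Set (Model Λ P → X)}

lemma image_chamber_subset_iff {f : Model Λ P → X} {v : Model Λ P} {w : V ≃ₗ[F] V} {Y : Set X} :
    f '' chamber P B v w ⊆ Y ↔ ∀ z ∈ fundChamber P B, f (v + act w z) ∈ Y := by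
  simp only [chamber, Set.image_image, Set.image_subset_iff]
  exact forall₂_congr fun z _ => by rw [Set.mem_preimage, add_comm]

lemma mem_image_chamber_iff {f : Model Λ P → X} {v : Model Λ P} {w : V ≃ₗ[F] V} {y : X} :
    y ∈ f '' chamber P B v w ↔ ∃ z ∈ fundChamber P B, f (v + act w z) = y := by
  simp only [chamber, Set.image_image]
  exact exists_congr fun z => and_congr_right fun _ => by rw [add_comm]

/-- `f (v + x) = g (v' + u x)` for all those `x` for which the left hand side lies in the image
of `g`. -/
def IsTransition (f g : Model Λ P → X) (v v' : Model Λ P) (u : V ≃ₗ[F] V) : Prop :=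
  ∀ x, f (v + x) ∈ Set.range g → f (v + x) = g (v' + act u x)

/-- Matching base points absorb the translation part, so relative positions depend on the linear
part alone. -/
lemma A2.exists_isTransition (hX : IsModeledOn P 𝒜) (h2 : A2 T d 𝒜) {f g : Model Λ P → X}
    (hf : f ∈ 𝒜) (hg : g ∈ 𝒜) {v v' : Model Λ P} (h : f v = g v') :
    ∃ u ∈ weylGroup P, IsTransition f g v v' u := by
  obtain ⟨-, -, _, ⟨u, hu, t, -, rfl⟩, heq⟩ := h2 f hf g hg ⟨f v, ⟨v, rfl⟩, ⟨v', h.symm⟩⟩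
  have hv : act u v + t = v' := by
    apply hX.injective g hg
    rw [← h]
    exact (heq ⟨v', h.symm⟩).symm
  refine ⟨u, hu, fun x hx => ?_⟩
  rw [heq hx, ← hv]
  simp only [Function.comp_apply, map_add]
  congr 1
  abel

lemma A2.isConvex (h2 : A2 T d 𝒜) {f g : Model Λ P → X}
    (hf : f ∈ 𝒜) (hg : g ∈ 𝒜) {v v' : Model Λ P} (h : f v = g v') :
    IsConvex P (f ⁻¹' Set.range g) :=
  (h2 f hf g hg ⟨f v, ⟨v, rfl⟩, ⟨v', h.symm⟩⟩).2.1

/-- The germ of the image under `f` of the chamber of direction `w C` based at `v` is contained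
in `Y`. -/
def GermMem (B : Set ι) (f : Model Λ P → X) (v : Model Λ P) (w : V ≃ₗ[F] V) (Y : Set X) : Prop :=
  ∃ η : Λ, 0 < η ∧ ∀ z ∈ fundChamber P B, (∀ i, |ev P i z| < η) → f (v + act w z) ∈ Y

lemma GermMem.apply_mem {f : Model Λ P → X} {v : Model Λ P} {w : V ≃ₗ[F] V} {Y : Set X}
    (h : GermMem B f v w Y) : f v ∈ Y := by
  obtain ⟨η, hη, h⟩ := h
  simpa using h 0 zero_mem_fundChamber fun i => by simpa using hη

lemma GermMem.inter {f : Model Λ P → X} {v : Model Λ P} {w : V ≃ₗ[F] V} {Y Y' : Set X}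
    (h : GermMem B f v w Y) (h' : GermMem B f v w Y') : GermMem B f v w (Y ∩ Y') := by
  obtain ⟨η, hη, h⟩ := h
  obtain ⟨η', hη', h'⟩ := h'
  exact ⟨min η η', lt_min hη hη', fun z hz hzη =>
    ⟨h z hz fun i => (hzη i).trans_le (min_le_left _ _),
      h' z hz fun i => (hzη i).trans_le (min_le_right _ _)⟩⟩

lemma GermMem.of_subset {f : Model Λ P → X} {v : Model Λ P} {w : V ≃ₗ[F] V} {Y : Set X} {ε : Λ}
    (hε : 0 < ε) (h : ∀ z ∈ fundChamber P B, f (v + act w z) ∈ Y) : GermMem B f v w Y :=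
  ⟨ε, hε, fun z hz _ => h z hz⟩

/-- A germ in the image of `f` which is contained in the image of `g` is transported by the
transition map. -/
lemma GermMem.transition {f g : Model Λ P → X} {v v' : Model Λ P} {u w : V ≃ₗ[F] V}
    (hu : IsTransition f g v v' u) (h : GermMem B f v w (Set.range g)) {Y : Set X} :
    GermMem B f v w Y ↔ GermMem B g v' (u * w) Y := by
  constructor
  · intro hY
    obtain ⟨η, hη, hYg⟩ := hY.inter h
    refine ⟨η, hη, fun z hz hzη => ?_⟩
    have := hYg z hz hzη
    rw [act_mul, ← hu _ this.2]
    exact this.1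
  · rintro ⟨η, hη, hY⟩
    obtain ⟨η', hη', h⟩ := h
    refine ⟨min η η', lt_min hη hη', fun z hz hzη => ?_⟩
    rw [hu _ (h z hz fun i => (hzη i).trans_le (min_le_right _ _)), ← act_mul]
    exact hY z hz fun i => (hzη i).trans_le (min_le_left _ _)

/-- The cocycle relation holds where all three transitions apply; this set contains a chamber germ,
which determines a linear map. -/
lemma IsTransition.eq_of_germMem [Finite ι] [P.IsRootSystem] (hX : IsModeledOn P 𝒜)
    (hξ : IsWeylVector P B ξ) {f g h : Model Λ P → X} (hh : h ∈ 𝒜) {v v' v'' : Model Λ P}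
    {w u₁ u₂ u₃ : V ≃ₗ[F] V} (h₁ : IsTransition f g v v' u₁) (h₂ : IsTransition g h v' v'' u₂)
    (h₃ : IsTransition f h v v'' u₃) (hg : GermMem B f v w (Set.range g))
    (hf : GermMem B f v w (Set.range h)) : u₃ * w = u₂ * u₁ * w := by
  obtain ⟨η, hη, hgf⟩ := hg.inter hf
  refine eq_of_eqOn_germ hξ hη fun z hz hzη => ?_
  have hz' := hgf z hz hzη
  have e1 := h₁ _ hz'.1
  have e3 := h₃ _ hz'.2
  have e2 := h₂ (act u₁ (act w z)) (by rw [← e1]; exact hz'.2)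
  rw [← e1, e3] at e2
  rw [act_mul, act_mul, act_mul]
  exact add_left_cancel (hX.injective h hh e2)

section Ball

variable (hd : IsModelMetric P d) (hX : IsModeledOn P 𝒜) (h2 : A2 T d 𝒜)
include hd hX h2

/-- Balls of `X` may be measured in any chart, but transitions only permute the coroots, so the
boxes seen in one chart suffice. -/
lemma germSubset_iff {f : Model Λ P → X} (hf : f ∈ 𝒜) {v : Model Λ P} {w : V ≃ₗ[F] V}
    (hw : w ∈ weylGroup P) {Y : Set X} :
    GermSubset d 𝒜 (f v) (f '' chamber P B v w) Y ↔ GermMem B f v w Y := by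
  constructor
  · rintro ⟨ε, hε, h⟩
    obtain ⟨η, hη, hball⟩ := hd.box_subset_ball ε hε
    refine ⟨η, hη, fun z hz hzη => h ⟨mem_image_chamber_iff.2 ⟨z, hz, rfl⟩, f, hf, v, _, rfl, rfl,
      hball _ _ fun i => ?_⟩⟩
    obtain ⟨k, hk⟩ := (exists_carries hw).1 i
    rw [add_sub_cancel_left, hk.ev_act]
    exact hzη k
  · rintro ⟨η, hη, h⟩
    obtain ⟨ε, hε, hbox⟩ := hd.ball_subset_box η hη
    refine ⟨ε, hε, ?_⟩
    rintro y ⟨hy, g, hg, a, b, ha, hb, hab⟩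
    obtain ⟨z, hz, rfl⟩ := mem_image_chamber_iff.1 hy
    refine h z hz fun k => ?_
    obtain ⟨u, hu, htr⟩ := h2.exists_isTransition hX hf hg ha.symm
    have h1 := htr _ ⟨b, hb⟩
    rw [← hb] at h1
    have h2 : b = a + act u (act w z) := hX.injective g hg h1
    obtain ⟨j, hj⟩ := (exists_carries (mul_mem hu hw)).2 k
    have h3 := hbox a b hab j
    rwa [h2, add_sub_cancel_left, ← act_mul, hj.ev_act] at h3

/-- The germ of a chamber is determined by its trace in any apartment which contains it. -/
lemma sameGerm_of_isTransition {f g : Model Λ P → X} (hf : f ∈ 𝒜) (hg : g ∈ 𝒜)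
    {v v' : Model Λ P} (h : f v = g v') {w u : V ≃ₗ[F] V} (hw : w ∈ weylGroup P)
    (hu : u ∈ weylGroup P) (htr : IsTransition f g v v' u)
    (hgm : GermMem B f v w (Set.range g)) :
    SameGerm d 𝒜 (f v) (f '' chamber P B v w) (g '' chamber P B v' (u * w)) := by
  have hS : GermMem B f v w (f '' chamber P B v w) := by
    obtain ⟨η, hη, -⟩ := hgm
    exact ⟨η, hη, fun z hz _ => mem_image_chamber_iff.2 ⟨z, hz, rfl⟩⟩
  have hT : GermMem B g v' (u * w) (g '' chamber P B v' (u * w)) := by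
    obtain ⟨η, hη, -⟩ := hgm
    exact ⟨η, hη, fun z hz _ => mem_image_chamber_iff.2 ⟨z, hz, rfl⟩⟩
  constructor
  · rw [germSubset_iff hd hX h2 hf hw]
    exact hS.inter ((hgm.transition htr).2 hT)
  · rw [h, germSubset_iff hd hX h2 hg (mul_mem hu hw)]
    exact ((hgm.transition htr).1 hS).inter hT

end Ball

/-! ### Opposite germs and apartments containing opposite chambers -/

section Opposite

variable [Finite ι] [P.IsRootSystem] (hB : IsRootBasis P B) (hξ : IsWeylVector P B ξ)
  (hd : IsModelMetric P d) (hX : IsModeledOn P 𝒜) (h2 : A2 T d 𝒜) (hGG : GG B d 𝒜)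
include hB hξ hd hX h2 hGG

/-- The data of an apartment containing the germs at `f v = g v'` of the chambers `g (v' + w' C)` and
`f (v + w C)`: a chart `h` with `h c = f v` and transitions `p` and `q`. -/
structure IsGermLink (B : Set ι) (𝒜 : Set (Model Λ P → X)) (g f : Model Λ P → X)
    (v' v : Model Λ P) (w' w : V ≃ₗ[F] V) (h : Model Λ P → X) (c : Model Λ P)
    (p q : V ≃ₗ[F] V) : Prop where
  mem : h ∈ 𝒜
  eq : h c = f v
  p_mem : p ∈ weylGroup P
  q_mem : q ∈ weylGroup P
  left : IsTransition g h v' c p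
  right : IsTransition f h v c q
  germ_left : GermMem B g v' w' (Set.range h)
  germ_right : GermMem B f v w (Set.range h)

omit hB hξ in
lemma exists_isGermLink {f g : Model Λ P → X} (hf : f ∈ 𝒜) (hg : g ∈ 𝒜) {v v' : Model Λ P}
    (h : f v = g v') {w w' : V ≃ₗ[F] V} (hw : w ∈ weylGroup P) (hw' : w' ∈ weylGroup P) :
    ∃ h c p q, IsGermLink B 𝒜 g f v' v w' w h c p q := by
  obtain ⟨_, ⟨k, hk, rfl⟩, h1, h1'⟩ := hGG (f v) _ _ ⟨g, hg, v', w', hw', h.symm, rfl⟩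
    ⟨f, hf, v, w, hw, rfl, rfl⟩
  rw [germSubset_iff hd hX h2 hf hw] at h1'
  rw [h, germSubset_iff hd hX h2 hg hw'] at h1
  obtain ⟨c, hc⟩ := h1'.apply_mem
  obtain ⟨p, hp, hp'⟩ := h2.exists_isTransition hX hg hk (h.symm.trans hc.symm)
  obtain ⟨q, hq, hq'⟩ := h2.exists_isTransition hX hf hk hc.symm
  exact ⟨k, c, p, q, hk, hc, hp, hq, hp', hq', h1, h1'⟩

/-- If in a common apartment some wall of a chamber germ does not separate it from a second germ, then
the first germ can be replaced by an adjacent one, in the given apartment, in such a way that the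
relative position with respect to the second germ changes by the corresponding reflection. -/
lemma IsGermLink.exists_adjacent {f g : Model Λ P → X} (hf : f ∈ 𝒜) (hg : g ∈ 𝒜)
    {v v' : Model Λ P} (hfg : f v = g v') {w w' : V ≃ₗ[F] V} (hw : w ∈ weylGroup P)
    (hw' : w' ∈ weylGroup P) {h : Model Λ P → X} {c : Model Λ P} {p q : V ≃ₗ[F] V}
    (H : IsGermLink B 𝒜 g f v' v w' w h c p q) {i : ι} (hi : i ∈ B)
    (hpos : 0 < P.coroot' i ((q * w)⁻¹ ((p * w') ξ))) :
    ∃ h' c' p' q', IsGermLink B 𝒜 g f v' v w' (w * P.reflection i) h' c' p' q' ∧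
      ∃ u ∈ weylGroup P, p' * w' = u * (p * w') ∧ q' * w = u * (q * w) := by
  obtain ⟨h', c', p', q', H'⟩ := exists_isGermLink hd hX h2 hGG hf hg hfg
    (mul_mem hw (reflection_mem_weylGroup i)) hw'
  refine ⟨h', c', p', q', H', ?_⟩
  have hcc : h c = h' c' := H.eq.trans H'.eq.symm
  obtain ⟨u, hu, hu'⟩ := h2.exists_isTransition hX H.mem H'.mem hcc
  have hp' := IsTransition.eq_of_germMem hX hξ H'.mem H.left hu' H'.left H.germ_left H'.germ_left
  rw [mul_assoc] at hp'
  refine ⟨u, hu, hp', ?_⟩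
  obtain ⟨μ, hμ⟩ := hB.exists_isPanelVector hi
  have hconv := h2.isConvex H.mem H'.mem hcc
  have hgerm : GermMem B h c (p * w') (Set.range h') :=
    (H.germ_left.transition H.left).1 H'.germ_left
  obtain ⟨η₁, hη₁, hη₁'⟩ := hgerm
  obtain ⟨r₁, hr₁, hr₁'⟩ := exists_abs_ev_tmul_lt (P := P) ξ hη₁
  obtain ⟨η₂, hη₂, hη₂'⟩ := H.germ_right
  obtain ⟨η₃, hη₃, hη₃'⟩ := H'.germ_right
  obtain ⟨r₂, hr₂, hr₂'⟩ := exists_abs_ev_tmul_lt (P := P) μ (lt_min hη₂ hη₃)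
  have hμC : (μ ⊗ₜ[F] r₂ : Model Λ P) ∈ fundChamber P B := tmul_mem_fundChamber hμ.nonneg hr₂.le
  -- The panel point is fixed by the reflection, so it belongs to both adjacent germs and hence to
  -- both apartments.
  have hpanel : h (c + act (q * w) (μ ⊗ₜ[F] r₂)) ∈ Set.range h' := by
    have e1 := H.right _ (hη₂' _ hμC fun i => (hr₂' i).trans_le (min_le_left _ _))
    rw [act_mul, ← e1]
    have e2 := hη₃' _ hμC fun i => (hr₂' i).trans_le (min_le_right _ _)
    rwa [act_mul, act_tmul (P.reflection i), P.reflection_apply, hμ.1, zero_smul, sub_zero] at e2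
  obtain ⟨η, hη, hη'⟩ := hconv.exists_germ_mem hB hξ (mul_mem H.q_mem hw) hμ ⟨c', hcc.symm⟩ hr₁
    (hη₁' _ (tmul_mem_fundChamber hξ.nonneg hr₁.le) hr₁') hr₂ hpanel hpos
  -- Convexity puts the old germ into the new apartment as well, so one transition `u` moves both
  -- members of the old pair.
  have hG : GermMem B f v w (Set.range h') := (H.germ_right.transition H.right).2 ⟨η, hη, hη'⟩
  rw [← mul_assoc]
  exact IsTransition.eq_of_germMem hX hξ H'.mem H.right hu' H'.right H.germ_right hG

omit hB hξ hd hX h2 hGG [Finite ι] [P.IsRootSystem] in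
lemma exists_coroot'_apply_eq_of_mem {w : V ≃ₗ[F] V} (hw : w ∈ weylGroup P) (j : ι) :
    ∃ k, P.coroot' j (w ξ) = P.coroot' k ξ :=
  ((exists_carries hw).1 j).imp fun _ hk => hk.1 ξ

omit hd hX h2 hGG in
lemma isOpp_of_forall_neg {a k : V ≃ₗ[F] V} (ha : a ∈ weylGroup P) (hk : k ∈ weylGroup P)
    (h : ∀ i ∈ B, P.coroot' i (k⁻¹ (a ξ)) < 0) : IsOpp P ξ a k := by
  cases nonempty_fintype ι
  intro j
  obtain ⟨l, hl⟩ := (exists_carries hk).1 j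
  obtain ⟨m, hm⟩ := exists_coroot'_apply_eq_of_mem (ξ := ξ) ha j
  have hne : P.coroot' j (a ξ) ≠ 0 := hm ▸ hξ.coroot'_ne_zero hB m
  have haj : P.coroot' j (a ξ) = P.coroot' l (k⁻¹ (a ξ)) := by
    rw [← hl.1]
    congr 1
    exact (k.apply_symm_apply _).symm
  rw [hl.1]
  obtain ⟨c, hc0, hcB, hc⟩ := hξ.exists_coroot'_eq hB l
  have hsum : (∑ i, c i • P.coroot' i) (k⁻¹ (a ξ)) ≤ 0 := by
    rw [LinearMap.sum_apply]
    refine Finset.sum_nonpos fun i _ => ?_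
    rw [LinearMap.smul_apply, smul_eq_mul]
    by_cases hi : i ∈ B
    · exact mul_nonpos_of_nonneg_of_nonpos (hc0 i) (h i hi).le
    · rw [hcB i hi, zero_mul]
  rcases hc with ⟨hpos, hc⟩ | ⟨hneg, hc⟩
  · refine mul_neg_of_neg_of_pos (lt_of_le_of_ne ?_ hne) hpos
    rw [haj, hc]
    exact hsum
  · refine mul_neg_of_pos_of_neg (lt_of_le_of_ne ?_ hne.symm) hneg
    rw [haj, hc, LinearMap.neg_apply]
    exact neg_nonneg.2 hsum

/-- Every apartment through the base point of a chamber contains a chamber germ opposite to the germ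
of this chamber. -/
lemma exists_isGermLink_isOpp {f g : Model Λ P → X} (hf : f ∈ 𝒜) (hg : g ∈ 𝒜) {v v' : Model Λ P}
    (hfg : f v = g v') {w' : V ≃ₗ[F] V} (hw' : w' ∈ weylGroup P) :
    ∃ w ∈ weylGroup P, ∃ h c p q, IsGermLink B 𝒜 g f v' v w' w h c p q ∧
      IsOpp P ξ (p * w') (q * w) := by
  obtain ⟨b, hb⟩ := exists_isInvariantForm (P := P)
  -- The relative positions of the fixed germ and the germs in the apartment of `f`, over all
  -- apartments linking them.
  let S : Set (weylGroup P) := {δ | ∃ w ∈ weylGroup P, ∃ h c p q,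
    IsGermLink B 𝒜 g f v' v w' w h c p q ∧ δ.1 = (p * w')⁻¹ * (q * w)}
  have hS : S.Nonempty := by
    obtain ⟨h, c, p, q, H⟩ := exists_isGermLink (B := B) hd hX h2 hGG hf hg hfg (one_mem _) hw'
    exact ⟨⟨_, mul_mem (inv_mem (mul_mem H.p_mem hw')) (mul_mem H.q_mem (one_mem _))⟩, 1,
      one_mem _, h, c, p, q, H, rfl⟩
  obtain ⟨⟨δ, hδ⟩, ⟨w, hw, h, c, p, q, H, rfl⟩, hmin⟩ :=
    S.toFinite.exists_minimalFor (fun δ => b ξ (δ.1 ξ)) S hS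
  have ha := mul_mem H.p_mem hw'
  have hk := mul_mem H.q_mem hw
  refine ⟨w, hw, h, c, p, q, H, isOpp_of_forall_neg hB hξ ha hk fun i hi => ?_⟩
  by_contra hneg
  have hx : (q * w)⁻¹ ((p * w') ξ) = ((q * w)⁻¹ * (p * w')) ξ := rfl
  have hpos : 0 < P.coroot' i ((q * w)⁻¹ ((p * w') ξ)) := by
    refine lt_of_le_of_ne (not_lt.1 hneg) (Ne.symm ?_)
    obtain ⟨m, hm⟩ := exists_coroot'_apply_eq_of_mem (ξ := ξ) (mul_mem (inv_mem hk) ha) i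
    rw [hx, hm]
    exact hξ.coroot'_ne_zero hB m
  obtain ⟨h', c', p', q', H', u, hu, hpu, hqu⟩ :=
    H.exists_adjacent hB hξ hd hX h2 hGG hf hg hfg hw hw' hi hpos
  have hδ' : (p' * w')⁻¹ * (q' * (w * P.reflection i)) =
      (p * w')⁻¹ * (q * w) * P.reflection i := by
    rw [← mul_assoc q', hpu, hqu]
    group
  have hs := reflection_mem_weylGroup (P := P) i
  have hle : b ξ (((p * w')⁻¹ * (q * w)) ξ) ≤
      b ξ (((p * w')⁻¹ * (q * w) * P.reflection i) ξ) := by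
    have hmem : (⟨(p * w')⁻¹ * (q * w) * P.reflection i, mul_mem hδ hs⟩ : weylGroup P) ∈ S :=
      ⟨w * P.reflection i, mul_mem hw hs, h', c', p', q', H', hδ'.symm⟩
    by_contra hlt
    exact hlt (hmin hmem (not_le.1 hlt).le)
  obtain ⟨e, he, heb⟩ := hb.coroot i
  -- Since s_iξ = ξ - α_i, moving the inverse of δ to the left argument shows that replacing δ by
  -- δs_i subtracts (δ⁻¹ξ, α_i), which is positive by `hpos`.
  have h1 : ∀ y, b ξ (((p * w')⁻¹ * (q * w)) y) = b ((q * w)⁻¹ ((p * w') ξ)) y := by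
    intro y
    rw [hx, ← hb.invariant _ hδ ((((q * w)⁻¹ * (p * w')) ξ)) y, ← LinearEquiv.mul_apply]
    congr 2
    have : (p * w')⁻¹ * (q * w) * ((q * w)⁻¹ * (p * w')) = 1 := by group
    rw [this]
    rfl
  rw [LinearEquiv.mul_apply _ (P.reflection i), h1, h1, P.reflection_apply, hξ i hi, one_smul,
    map_sub, le_sub_self_iff, hb.symm] at hle
  rw [heb] at hpos
  exact ((mul_pos_iff_of_pos_left he).1 hpos).not_ge hle

variable (hCO : CO B d 𝒜)
include hCO

/-- Given a chamber based at a point of an apartment, there is a chamber with the same base point in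
this apartment such that some apartment contains both of them, and in this apartment they are
opposite. -/
lemma exists_isOpp_apartment {ε : Λ} (hε : 0 < ε) {f g : Model Λ P → X} (hf : f ∈ 𝒜)
    (hg : g ∈ 𝒜) {v v' : Model Λ P} (hfg : f v = g v') {w' : V ≃ₗ[F] V}
    (hw' : w' ∈ weylGroup P) :
    ∃ w : weylGroup P, ∃ h ∈ 𝒜, ∃ c, ∃ k₁ ∈ weylGroup P, ∃ k₂ ∈ weylGroup P, IsOpp P ξ k₁ k₂ ∧
      (∀ z ∈ fundChamber P B, g (v' + act w' z) = h (c + act k₁ z)) ∧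
      ∀ z ∈ fundChamber P B, f (v + act w.1 z) = h (c + act k₂ z) := by
  obtain ⟨w, hw, g₀, c₀, p, q, H, hopp⟩ :=
    exists_isGermLink_isOpp (B := B) hB hξ hd hX h2 hGG hf hg hfg hw'
  have ha := mul_mem H.p_mem hw'
  have hk := mul_mem H.q_mem hw
  have hlong : IsLongest P B ((p * w')⁻¹ * (q * w)) := by
    refine IsOpp.isLongest hξ hB (mul_mem (inv_mem ha) hk) ?_
    have := hopp.mul_left (inv_mem ha)
    rwa [inv_mul_cancel] at this
  have hOpp : Opposite B d 𝒜 (f v) (g '' chamber P B v' w') (f '' chamber P B v w) := by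
    refine ⟨g₀, H.mem, c₀, p * w', ha, _, hlong, H.eq, ?_, ?_⟩
    · rw [hfg]
      exact sameGerm_of_isTransition hd hX h2 hg H.mem (hfg.symm.trans H.eq.symm) hw' H.p_mem
        H.left H.germ_left
    · rw [mul_inv_cancel_left]
      exact sameGerm_of_isTransition hd hX h2 hf H.mem H.eq.symm hw H.q_mem H.right H.germ_right
  obtain ⟨_, ⟨⟨h, hh, rfl⟩, hgh, hfh⟩, -⟩ := hCO (f v) _ _ ⟨g, hg, v', w', hw', hfg.symm, rfl⟩
    ⟨f, hf, v, w, hw, rfl, rfl⟩ hOpp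
  rw [image_chamber_subset_iff] at hgh hfh
  obtain ⟨c, hc⟩ : f v ∈ Set.range h := by simpa using hfh 0 zero_mem_fundChamber
  obtain ⟨p', hp', htp⟩ := h2.exists_isTransition hX hg hh (hfg.symm.trans hc.symm)
  obtain ⟨q', hq', htq⟩ := h2.exists_isTransition hX hf hh hc.symm
  -- The opposition is known in the apartment of the germs; this transition carries it to the
  -- apartment of the whole chambers.
  obtain ⟨u, hu, htu⟩ := h2.exists_isTransition hX H.mem hh (H.eq.trans hc.symm)
  have e1 := IsTransition.eq_of_germMem hX hξ hh H.left htu htp H.germ_left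
    (GermMem.of_subset hε hgh)
  have e2 := IsTransition.eq_of_germMem hX hξ hh H.right htu htq H.germ_right
    (GermMem.of_subset hε hfh)
  refine ⟨⟨w, hw⟩, h, hh, c, p' * w', mul_mem hp' hw', q' * w, mul_mem hq' hw, ?_, fun z hz => ?_,
    fun z hz => ?_⟩
  · rw [e1, e2, mul_assoc, mul_assoc]
    exact hopp.mul_left hu
  · rw [htp _ (hgh z hz), act_mul]
  · rw [htq _ (hfh z hz), act_mul]

end Opposite

end Germs

/-! ### Common apartments for a chamber and a point, and for two chambers -/

section Apartments

variable {F : Subfield ℝ} {ι V N Λ X : Type*}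
  [AddCommGroup V] [Module F V] [AddCommGroup N] [Module F N]
  [AddCommGroup Λ] [LinearOrder Λ] [IsOrderedAddMonoid Λ] [Module F Λ] [IsStrictOrderedModule F Λ]
  {P : RootPairing ι F V N} {B : Set ι} {ξ : V} {T : AddSubgroup (Model Λ P)}
  {d : Model Λ P → Model Λ P → Λ} {𝒜 : Set (Model Λ P → X)}

/-- Otherwise some nonnegative `M` dominates a strict bound of every fibre, yet lies in one of them.
-/
lemma exists_cofinal_fiber {κ : Type*} [Finite κ] (u : Λ → κ) :
    ∃ i, Cofinal {r | 0 ≤ r ∧ u r = i} := by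
  by_contra! h
  simp only [Cofinal, not_forall, not_exists, not_and, Set.mem_ofPred_eq] at h
  choose b hb using h
  obtain ⟨M, hM⟩ := Finite.exists_le fun o : Option κ => o.elim 0 b
  exact hb (u M) M ⟨hM none, rfl⟩ (hM (some (u M)))

variable [Finite ι] [P.IsRootSystem] (hB : IsRootBasis P B) (hξ : IsWeylVector P B ξ)
  (hd : IsModelMetric P d) (hX : IsModeledOn P 𝒜) (h2 : A2 T d 𝒜) (h3 : A3 𝒜) (hGG : GG B d 𝒜)
  (hCO : CO B d 𝒜) {ε : Λ} (hε : 0 < ε)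
include hB hξ hd hX h2 h3 hGG hCO hε

/-- For each chamber and each point some apartment contains the point and a subchamber. -/
lemma exists_apartment_of_point (p : X) {f : Model Λ P → X} (hf : f ∈ 𝒜) (v : Model Λ P)
    {w : V ≃ₗ[F] V} (hw : w ∈ weylGroup P) :
    ∃ h ∈ 𝒜, ∃ r : Λ, 0 ≤ r ∧ p ∈ Set.range h ∧
      ∀ z ∈ fundChamber P B, f (v + act w (ξ ⊗ₜ[F] r) + act w z) ∈ Set.range h := by
  have data : ∀ r : Λ, ∃ u : weylGroup P, ∃ h ∈ 𝒜, ∃ q, h q = p ∧ ∃ k ∈ weylGroup P,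
      ∃ z₀ ∈ fundChamber P B, f (v + act w (ξ ⊗ₜ[F] r)) = h (q + act k z₀) ∧
      ∃ c, ∀ z ∈ fundChamber P B, f (v + act w (ξ ⊗ₜ[F] r) + act u.1 z) = h (c + act k z) := by
    intro r
    obtain ⟨_, ⟨g, hg, rfl⟩, ⟨a, ha⟩, ⟨b, hb⟩⟩ := h3 (f (v + act w (ξ ⊗ₜ[F] r))) p
    -- The direction `w'` is chosen so that the chamber based at the ray point contains `p`.
    obtain ⟨w', hw', y, hy, hyb⟩ := exists_act_eq hB hξ (b - a)
    obtain ⟨u, h, hh, c, k₁, hk₁, k₂, hk₂, hopp, hgh, hfh⟩ :=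
      exists_isOpp_apartment hB hξ hd hX h2 hGG hCO hε hf hg ha.symm hw'
    -- Seen from `p`, the ray point lies in the direction of the opposite chamber.
    obtain ⟨z', hz', hzz'⟩ := hopp.exists_act_eq_neg hB hξ hk₁ hk₂ hy
    refine ⟨u, h, hh, c + act k₁ y, ?_, k₂, hk₂, z', hz', ?_, c, hfh⟩
    · rw [← hgh y hy, hyb, add_sub_cancel, hb]
    · rw [hzz', add_neg_cancel_right]
      simpa using hfh 0 zero_mem_fundChamber
  choose u h hh q hq k hk z₀ hz₀ hs c hc using data
  obtain ⟨u₀, hR⟩ := exists_cofinal_fiber u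
  obtain ⟨r₀, ⟨hr₀, hu₀⟩, -⟩ := hR 0
  refine ⟨h r₀, hh r₀, r₀, hr₀, ⟨_, hq r₀⟩, ?_⟩
  have hmem : ∀ r ∈ {r | 0 ≤ r ∧ u r = u₀},
      v + act w (ξ ⊗ₜ[F] r) ∈ f ⁻¹' Set.range (h r₀) := by
    rintro r ⟨-, hur⟩
    obtain ⟨z₁, hz₁, z₁', hz₁', hz⟩ := exists_add_act_eq (P := P) (B := B) hξ
      (v + act w (ξ ⊗ₜ[F] r)) (v + act w (ξ ⊗ₜ[F] r₀)) u₀.1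
    have hdeep : ∀ z ∈ fundChamber P B,
        h r (c r + act (k r) z₁ + act (k r) z) = h r₀ (c r₀ + act (k r₀) z₁' + act (k r₀) z) := by
      intro z hzC
      rw [add_assoc, add_assoc, ← map_add, ← map_add, ← hc r _ (add_mem_fundChamber hz₁ hzC),
        ← hc r₀ _ (add_mem_fundChamber hz₁' hzC), hur, hu₀, map_add, map_add, ← add_assoc,
        ← add_assoc, hz]
    have hqq : h r (q r) = h r₀ (q r₀) := (hq r).trans (hq r₀).symm
    have hconv := h2.isConvex (hh r) (hh r₀) hqq
    obtain ⟨θ, -, hθ⟩ := h2.exists_isTransition hX (hh r) (hh r₀) hqq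
    -- The overlap of the two apartments contains `p` and a chamber of direction `k r`, hence the
    -- parallel chamber based at `p`.
    have hapex := fun z (hz : z ∈ fundChamber P B) => hθ _ <|
      hconv.add_mem_of_chamber hB hξ hε (hk r) (fun z hz => ⟨_, (hdeep z hz).symm⟩)
        ⟨_, hqq.symm⟩ hz
    have htr : ∀ z ∈ fundChamber P B,
        act θ (c r + act (k r) z₁ - q r) + act θ (act (k r) z) + q r₀ =
          c r₀ + act (k r₀) z₁' + act (k r₀) z := by
      intro z hzC
      apply hX.injective _ (hh r₀)
      rw [← hdeep z hzC, ← map_add, add_comm _ (q r₀), ← hθ _ ?_]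
      · congr 1
        abel
      · refine ⟨_, (hdeep z hzC).symm.trans ?_⟩
        congr 1
        abel
    have h0 := htr 0 zero_mem_fundChamber
    have h1 := htr _ (hz₀ r)
    -- Comparing the shared subchamber at its apex and at `z₀ r` removes the translation.
    have hlin : act θ (act (k r) (z₀ r)) = act (k r₀) (z₀ r) := by
      simp only [map_zero, add_zero] at h0
      rw [← h0] at h1
      rw [add_right_comm] at h1
      exact add_left_cancel h1
    refine ⟨q r₀ + act (k r₀) (z₀ r), ?_⟩
    rw [hs r, hapex _ (hz₀ r), hlin]
  have hconv : IsConvex P (f ⁻¹' Set.range (h r₀)) := by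
    obtain ⟨y, hy⟩ := hmem r₀ ⟨hr₀, hu₀⟩
    exact h2.isConvex hf (hh r₀) hy.symm
  intro z hz
  exact hconv.add_mem_of_cofinal hB hξ hε hw hR hmem (hmem r₀ ⟨hr₀, hu₀⟩) hz

/-- Any two chambers contain subchambers which lie in a common apartment. -/
lemma exists_apartment_of_chambers {f g : Model Λ P → X} (hf : f ∈ 𝒜) (hg : g ∈ 𝒜)
    (v v' : Model Λ P) {w w' : V ≃ₗ[F] V} (hw : w ∈ weylGroup P) (hw' : w' ∈ weylGroup P) :
    ∃ h ∈ 𝒜, ∃ y ∈ fundChamber P B, ∃ y' ∈ fundChamber P B,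
      (∀ z ∈ fundChamber P B, f (v + act w y + act w z) ∈ Set.range h) ∧
      ∀ z ∈ fundChamber P B, g (v' + act w' y' + act w' z) ∈ Set.range h := by
  have data : ∀ r : Λ, ∃ u : weylGroup P, ∃ h ∈ 𝒜, ∃ k₁ ∈ weylGroup P, ∃ k₂ ∈ weylGroup P,
      IsOpp P ξ k₁ k₂ ∧ ∃ y' ∈ fundChamber P B, ∃ c₁ c₂,
      (∀ z ∈ fundChamber P B, g (v' + act w' y' + act w' z) = h (c₁ + act k₁ z)) ∧
      ∀ z ∈ fundChamber P B, f (v + act w (ξ ⊗ₜ[F] r) + act u.1 z) = h (c₂ + act k₂ z) := by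
    intro r
    obtain ⟨e, he, s, hs, ⟨a, ha⟩, hge⟩ := exists_apartment_of_point hB hξ hd hX h2 h3 hGG hCO hε
      (f (v + act w (ξ ⊗ₜ[F] r))) hg v' hw'
    obtain ⟨b, hb⟩ : g (v' + act w' (ξ ⊗ₜ[F] s)) ∈ Set.range e := by
      simpa using hge 0 zero_mem_fundChamber
    obtain ⟨t, ht, htr⟩ := h2.exists_isTransition hX hg he hb.symm
    obtain ⟨u, h, hh, c, k₁, hk₁, k₂, hk₂, hopp, heh, hfh⟩ :=
      exists_isOpp_apartment hB hξ hd hX h2 hGG hCO hε hf he ha.symm (mul_mem ht hw')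
    -- Inside `e`, the subchamber of the second chamber and the parallel chamber based at the ray
    -- point have a common subchamber, which thus lies in `h`.
    obtain ⟨z₁, hz₁, z₁', hz₁', hz⟩ := exists_add_act_eq (P := P) (B := B) hξ b a (t * w')
    refine ⟨u, h, hh, k₁, hk₁, k₂, hk₂, hopp, ξ ⊗ₜ[F] s + z₁,
      add_mem_fundChamber (tmul_mem_fundChamber hξ.nonneg hs) hz₁, c + act k₁ z₁', c,
      fun z hzC => ?_, hfh⟩
    have h1 := htr _ (hge _ (add_mem_fundChamber hz₁ hzC))
    rw [← act_mul, map_add, map_add, ← add_assoc, ← add_assoc, hz, add_assoc a, ← map_add,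
      heh _ (add_mem_fundChamber hz₁' hzC), map_add, ← add_assoc] at h1
    rw [map_add, ← add_assoc]
    exact h1
  choose u h hh k₁ hk₁ k₂ hk₂ hopp y' hy' c₁ c₂ hgh hfh using data
  obtain ⟨u₀, hR⟩ := exists_cofinal_fiber u
  obtain ⟨r₀, ⟨hr₀, hu₀⟩, -⟩ := hR 0
  refine ⟨h r₀, hh r₀, ξ ⊗ₜ[F] r₀, tmul_mem_fundChamber hξ.nonneg hr₀, y' r₀, hy' r₀, ?_,
    fun z hz => ⟨_, (hgh r₀ z hz).symm⟩⟩
  have hmem : ∀ r ∈ {r | 0 ≤ r ∧ u r = u₀},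
      v + act w (ξ ⊗ₜ[F] r) ∈ f ⁻¹' Set.range (h r₀) := by
    rintro r ⟨-, hur⟩
    obtain ⟨z₁, hz₁, z₁', hz₁', hz⟩ := exists_add_act_eq (P := P) (B := B) hξ
      (v' + act w' (y' r)) (v' + act w' (y' r₀)) w'
    obtain ⟨z₂, hz₂, z₂', hz₂', hz'⟩ := exists_add_act_eq (P := P) (B := B) hξ
      (v + act w (ξ ⊗ₜ[F] r)) (v + act w (ξ ⊗ₜ[F] r₀)) u₀.1
    have hdeep₁ : ∀ z ∈ fundChamber P B,
        h r (c₁ r + act (k₁ r) z₁ + act (k₁ r) z) ∈ Set.range (h r₀) := by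
      intro z hzC
      rw [add_assoc, ← map_add, ← hgh r _ (add_mem_fundChamber hz₁ hzC), map_add, ← add_assoc, hz,
        add_assoc, ← map_add, hgh r₀ _ (add_mem_fundChamber hz₁' hzC)]
      exact ⟨_, rfl⟩
    have hdeep₂ : ∀ z ∈ fundChamber P B,
        h r (c₂ r + act (k₂ r) z₂ + act (k₂ r) z) ∈ Set.range (h r₀) := by
      intro z hzC
      rw [add_assoc, ← map_add, ← hfh r _ (add_mem_fundChamber hz₂ hzC), hur, map_add, ← add_assoc,
        hz', add_assoc, ← map_add, ← hu₀, hfh r₀ _ (add_mem_fundChamber hz₂' hzC)]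
      exact ⟨_, rfl⟩
    obtain ⟨x, hx⟩ := hdeep₁ 0 zero_mem_fundChamber
    have hconv := h2.isConvex (hh r) (hh r₀) hx.symm
    have h0 := hfh r 0 zero_mem_fundChamber
    rw [map_zero, add_zero] at h0
    rw [Set.mem_preimage, h0]
    -- The overlap contains chambers of two opposite directions of `h r`, so it is the whole
    -- apartment, ray point included.
    exact hconv.mem_of_isOpp hB hξ hε (hk₁ r) (hk₂ r) (hopp r) hdeep₁ hdeep₂ _
  have hconv : IsConvex P (f ⁻¹' Set.range (h r₀)) := by
    obtain ⟨y, hy⟩ := hmem r₀ ⟨hr₀, hu₀⟩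
    exact h2.isConvex hf (hh r₀) hy.symm
  intro z hz
  exact hconv.add_mem_of_cofinal hB hξ hε hw hR hmem (hmem r₀ ⟨hr₀, hu₀⟩) hz

end Apartments

end LambdaBuilding

end

theorem mainTheorem8 {F : Subfield ℝ} {ι V N Λ X : Type*} [Finite ι]
    [AddCommGroup V] [Module F V] [AddCommGroup N] [Module F N]
    (P : RootPairing ι F V N) [P.IsRootSystem]
    (B : Set ι) (hB : LambdaBuilding.IsRootBasis P B)
    [AddCommGroup Λ] [LinearOrder Λ] [IsOrderedAddMonoid Λ] [Module F Λ] [IsStrictOrderedModule F Λ]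
    (d : LambdaBuilding.Model Λ P → LambdaBuilding.Model Λ P → Λ)
    (hd : LambdaBuilding.IsModelMetric P d)
    (T : AddSubgroup (LambdaBuilding.Model Λ P))
    (hT : ∀ w ∈ LambdaBuilding.weylGroup P, ∀ t ∈ T, LambdaBuilding.act w t ∈ T)
    (𝒜 : Set (LambdaBuilding.Model Λ P → X))
    (hX : LambdaBuilding.IsModeledOn P 𝒜)
    (h1 : LambdaBuilding.A1 T 𝒜) (h2 : LambdaBuilding.A2 T d 𝒜) (h3 : LambdaBuilding.A3 𝒜)
    (hGG : LambdaBuilding.GG B d 𝒜) (hCO : LambdaBuilding.CO B d 𝒜) :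
    LambdaBuilding.A4 B 𝒜 := by
  open LambdaBuilding in
  intro S S' hS hS'
  obtain ⟨x, hS⟩ := hS
  obtain ⟨x', hS'⟩ := hS'
  -- (GG) is applied only to obtain a positive element of `Λ`, which excludes `Λ = 0`.
  obtain ⟨_, -, ⟨ε, hε, -⟩, -⟩ := hGG x S S hS hS
  obtain ⟨f, hf, v, w, hw, -, rfl⟩ := hS
  obtain ⟨g, hg, v', w', hw', -, rfl⟩ := hS'
  obtain ⟨ξ, hξ⟩ := hB.exists_isWeylVector
  obtain ⟨h, hh, y, hy, y', hy', h₁, h₂⟩ :=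
    exists_apartment_of_chambers hB hξ hd hX h2 h3 hGG hCO hε hf hg v v' hw hw'
  refine ⟨_, _, ⟨_, f, hf, v + act w y, w, hw, rfl, rfl⟩, ?_,
    ⟨_, g, hg, v' + act w' y', w', hw', rfl, rfl⟩, ?_, _, ⟨h, hh, rfl⟩,
    image_chamber_subset_iff.2 h₁, image_chamber_subset_iff.2 h₂⟩
  · refine image_chamber_subset_iff.2 fun z hz => mem_image_chamber_iff.2
      ⟨y + z, add_mem_fundChamber hy hz, ?_⟩
    rw [map_add, add_assoc]
  · refine image_chamber_subset_iff.2 fun z hz => mem_image_chamber_iff.2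
      ⟨y' + z, add_mem_fundChamber hy' hz, ?_⟩
    rw [map_add, add_assoc]
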